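/- Let $X$ be a second-countable locally compact Hausdorff space, $\mathfrak M^+$ the cone of positive Radon measures on $X$, and $\kappa:X\times X\to[0,\infty]$ a kernel (symmetric, lower semicontinuous). For $\mu,\nu\in\mathfrak M^+$ write $U^\mu(x)=\int\kappa(x,y)\,d\mu(y)$, $I(\mu,\nu)=\int\kappa\,d(\mu\otimes\nu)$, $I(\mu)=I(\mu,\mu)$, $\|\mu\|=\sqrt{I(\mu)}$; let $\mathcal E^+=\{\mu\in\mathfrak M^+: I(\mu)<\infty\}$ and, for $A\subset X$, let $\mathcal E^+(A)$ be the set of all $\mu\in\mathcal E^+$ for which $X\setminus A$ is $\mu$-negligible, and $\breve{\mathcal E}^+(A)=\{\mu\in\mathcal E^+(A):\mu(X)=1\}$. Assume that $\kappa$ satisfies - the energy principle: $I(\mu)\ge0$ for all signed Radon measures $\mu$ for which $I(\mu)$ is defined, with $I(\mu)=0$ only for $\mu=0$; - the consistency principle: $\mathcal E^+$ is complete in the strong topology (given by the energy norm), and on $\mathcal E^+$ the strong topology is finer than the vague topology; - the domination principle: if $\mu\in\mathcal E^+$, $\nu\in\mathfrak M^+$ and $U^\mu\le U^\nu$ $\mu$-a.e.,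 then $U^\mu\le U^\nu$ on $X$; - Frostman's maximum principle: if $\mu\in\mathcal E^+$, $0<c<\infty$ and $U^\mu\le c$ $\mu$-a.e., then $U^\mu\le c$ on $X$. For compact $K$ let $c(K)=1/\inf\{I(\mu):\mu\in\mathfrak M^+,\ \mu(X\setminus K)=0,\ \mu(X)=1\}$, and let $c_*(A)=\sup\{c(K):K\subset A\text{ compact}\}$ be the inner capacity; a property holds nearly everywhere (n.e.) on $A$ if the set of all $x\in A$ where it fails has inner capacity zero. Let $A\subset X$ be a set with $c_*(A)>0$ such that $\mathcal E^+(A)$ is strongly closed. Let $\omega\in\mathfrak M^+$, $\omega\neq0$, be such that either $\omega\in\mathcal E^+$, or $\omega(X)<\infty$, $U^\omega|_K$ is upper semicontinuous for every compact $K\subset A$, and $\sup_A U^\omega<\infty$. Put $f=-U^\omega$, $U_f^\mu=U^\mu-U^\omega$, and $I_f(\mu)=\|\mu\|^2-2\int U^\omega\,d\mu$. The inner balayage $\omega^A$ is the unique measure in $\mathcal E^+(A)$ with $U^{\omega^A}=U^\omega$ n.e. on $A$. If $c_*(A)<\infty$, the inner equilibrium measure $\gamma_A$ is the unique measure of least energy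 among all $\mu\in\mathcal E^+(A)$ with $\mu(X)=c_*(A)$. Assume that there is a (necessarily unique) $\lambda_{A,f}\in\breve{\mathcal E}^+(A)$ minimizing $I_f$ over $\breve{\mathcal E}^+(A)$, and that $\omega^A(X)\le1$. Let $$c_{A,f}=\int U_f^{\lambda_{A,f}}\,d\lambda_{A,f},\qquad \Lambda_{A,f}=\{\mu\in\mathcal E^+:\ U_f^\mu\ge c_{A,f}\ \text{n.e. on }A\}.$$ Then $$\lambda_{A,f}=\begin{cases}\omega^A+c_{A,f}\,\gamma_A&\text{if }c_*(A)<\infty,\\ \omega^A&\text{if }c_*(A)=\infty,\end{cases}$$ and $\lambda_{A,f}$ is characterized by any one of the following assertions: 1. $\lambda_{A,f}$ is the unique measure of minimum potential in $\Lambda_{A,f}$, that is, the unique $\lambda\in\Lambda_{A,f}$ such that $U^{\lambda}\le U^\mu$ on $X$ for all $\mu\in\Lambda_{A,f}$; 2. $\lambda_{A,f}$ is the unique measure of minimum energy norm in $\Lambda_{A,f}$, that is, the unique $\lambda\in\Lambda_{A,f}$ such that $\|\lambda\|\le\|\mu\|$ for all $\mu\in\Lambda_{A,f}$; 3. $\lambda_{A,f}$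 is the unique $\mu\in\mathcal E^+(A)$ with $U_f^\mu=c_{A,f}$ n.e. on $A$. Furthermore, $c_{A,f}\ge0$ if $c_*(A)<\infty$, and $c_{A,f}=0$ if $c_*(A)=\infty$. -/

import Mathlib

open MeasureTheory Filter Topology
open scoped ENNReal NNReal

namespace Balayage

noncomputable section

/-- Positive Radon measures on `X` (the cone `𝔐⁺`). On a second-countable locally compact Hausdorff
space these are exactly the Borel measures that are finite on compact sets. -/
def IsRadon {X : Type*} [TopologicalSpace X] [MeasurableSpace X] (μ : Measure X) : Prop :=
  IsFiniteMeasureOnCompacts μ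

/-- A kernel: a symmetric lower semicontinuous function `X × X → [0, ∞]`. -/
structure IsKernel {X : Type*} [TopologicalSpace X] (κ : X → X → ℝ≥0∞) : Prop where
  symm : ∀ x y, κ x y = κ y x
  lsc : LowerSemicontinuous (fun p : X × X => κ p.1 p.2)

/-- The potential `U^μ(x) = ∫ κ(x, y) dμ(y)`. -/
def potential {X : Type*} [MeasurableSpace X] (κ : X → X → ℝ≥0∞) (μ : Measure X) (x : X) : ℝ≥0∞ :=
  ∫⁻ y, κ x y ∂μ

/-- The mutual energy `I(μ, ν) = ∫ κ d(μ ⊗ ν)` of two positive measures. -/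
def mutualEnergy {X : Type*} [MeasurableSpace X] (κ : X → X → ℝ≥0∞) (μ ν : Measure X) : ℝ≥0∞ :=
  ∫⁻ p : X × X, κ p.1 p.2 ∂(μ.prod ν)

/-- The energy `I(μ) = I(μ, μ)`. -/
def energy {X : Type*} [MeasurableSpace X] (κ : X → X → ℝ≥0∞) (μ : Measure X) : ℝ≥0∞ :=
  mutualEnergy κ μ μ

/-- The energy norm `‖μ‖ = √I(μ)`, used for measures of finite energy. -/
def energyNorm {X : Type*} [MeasurableSpace X] (κ : X → X → ℝ≥0∞) (μ : Measure X) : ℝ :=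
  √((energy κ μ).toReal)

/-- The cone `𝓔⁺` of positive Radon measures of finite energy. -/
def finiteEnergy {X : Type*} [TopologicalSpace X] [MeasurableSpace X] (κ : X → X → ℝ≥0∞) :
    Set (Measure X) :=
  {μ | IsRadon μ ∧ energy κ μ < ∞}

/-- The cone `𝓔⁺(A)` of all `μ ∈ 𝓔⁺` concentrated on `A`, i.e. such that the complement of `A` is
`μ`-negligible (the set `A` need not be Borel; `μ Aᶜ` is then the outer measure of `Aᶜ`). -/
def finiteEnergyOn {X : Type*} [TopologicalSpace X] [MeasurableSpace X] (κ : X → X → ℝ≥0∞)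
    (A : Set X) : Set (Measure X) :=
  {μ | μ ∈ finiteEnergy κ ∧ μ Aᶜ = 0}

/-- The class of all `μ ∈ 𝓔⁺(A)` of total mass one. -/
def unitFiniteEnergyOn {X : Type*} [TopologicalSpace X] [MeasurableSpace X] (κ : X → X → ℝ≥0∞)
    (A : Set X) : Set (Measure X) :=
  {μ | μ ∈ finiteEnergyOn κ A ∧ μ Set.univ = 1}

/-- The energy principle (strict positive definiteness). A signed Radon measure is a difference
`μ - ν` of two positive ones, and `I(μ - ν) = I(μ) + I(ν) - 2 I(μ, ν)`; if `I(μ) + I(ν) = ∞`, the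
first inequality holds trivially. -/
structure EnergyPrinciple {X : Type*} [TopologicalSpace X] [MeasurableSpace X]
    (κ : X → X → ℝ≥0∞) : Prop where
  nonneg : ∀ μ ν : Measure X, IsRadon μ → IsRadon ν →
    2 * mutualEnergy κ μ ν ≤ energy κ μ + energy κ ν
  definite : ∀ μ ν : Measure X, μ ∈ finiteEnergy κ → ν ∈ finiteEnergy κ →
    2 * mutualEnergy κ μ ν = energy κ μ + energy κ ν → μ = ν

/-- The distance `‖μ - ν‖` in the energy norm between `μ, ν ∈ 𝓔⁺`; it defines the strong
topology. -/
def energyDist {X : Type*} [MeasurableSpace X] (κ : X → X → ℝ≥0∞) (μ ν : Measure X) : ℝ :=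
  √((energy κ μ).toReal + (energy κ ν).toReal - 2 * (mutualEnergy κ μ ν).toReal)

/-- Strong convergence of a sequence. -/
def StrongTendsto {X : Type*} [MeasurableSpace X] (κ : X → X → ℝ≥0∞) (μ : ℕ → Measure X)
    (ν : Measure X) : Prop :=
  Tendsto (fun n => energyDist κ (μ n) ν) atTop (𝓝 0)

/-- Strong Cauchy sequences. -/
def StrongCauchySeq {X : Type*} [MeasurableSpace X] (κ : X → X → ℝ≥0∞) (μ : ℕ → Measure X) :
    Prop :=
  ∀ ε : ℝ, 0 < ε → ∃ N : ℕ, ∀ m ≥ N, ∀ n ≥ N, energyDist κ (μ m) (μ n) < ε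

/-- Vague convergence of a sequence of positive Radon measures. -/
def VagueTendsto {X : Type*} [TopologicalSpace X] [MeasurableSpace X] (μ : ℕ → Measure X)
    (ν : Measure X) : Prop :=
  ∀ φ : X → ℝ, Continuous φ → HasCompactSupport φ →
    Tendsto (fun n => ∫ x, φ x ∂(μ n)) atTop (𝓝 (∫ x, φ x ∂ν))

/-- The consistency principle: `𝓔⁺` is strongly complete, and the strong topology on `𝓔⁺` is finer
than the vague one. (The strong topology is given by a metric, so sequences suffice.) -/
structure ConsistencyPrinciple {X : Type*} [TopologicalSpace X] [MeasurableSpace X]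
    (κ : X → X → ℝ≥0∞) : Prop where
  complete : ∀ μ : ℕ → Measure X, (∀ n, μ n ∈ finiteEnergy κ) → StrongCauchySeq κ μ →
    ∃ ν ∈ finiteEnergy κ, StrongTendsto κ μ ν
  finer : ∀ (μ : ℕ → Measure X) (ν : Measure X), (∀ n, μ n ∈ finiteEnergy κ) →
    ν ∈ finiteEnergy κ → StrongTendsto κ μ ν → VagueTendsto μ ν

/-- The domination principle. -/
def DominationPrinciple {X : Type*} [TopologicalSpace X] [MeasurableSpace X]
    (κ : X → X → ℝ≥0∞) : Prop :=
  ∀ μ ν : Measure X, μ ∈ finiteEnergy κ → IsRadon ν →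
    (∀ᵐ x ∂μ, potential κ μ x ≤ potential κ ν x) → ∀ x, potential κ μ x ≤ potential κ ν x

/-- Frostman's maximum principle. -/
def FrostmanPrinciple {X : Type*} [TopologicalSpace X] [MeasurableSpace X]
    (κ : X → X → ℝ≥0∞) : Prop :=
  ∀ μ : Measure X, μ ∈ finiteEnergy κ → ∀ c : ℝ≥0, 0 < c →
    (∀ᵐ x ∂μ, potential κ μ x ≤ c) → ∀ x, potential κ μ x ≤ c

/-- The capacity of a compact set `K`: the reciprocal of the infimum of `I(μ)` over all positive
Radon measures `μ` of total mass one concentrated on `K`. -/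
def compactCapacity {X : Type*} [TopologicalSpace X] [MeasurableSpace X] (κ : X → X → ℝ≥0∞)
    (K : Set X) : ℝ≥0∞ :=
  (⨅ (μ : Measure X) (_ : IsRadon μ) (_ : μ Kᶜ = 0) (_ : μ Set.univ = 1), energy κ μ)⁻¹

/-- The inner capacity `c_*(A)`: the supremum of the capacities of the compact subsets of `A`. -/
def innerCapacity {X : Type*} [TopologicalSpace X] [MeasurableSpace X] (κ : X → X → ℝ≥0∞)
    (A : Set X) : ℝ≥0∞ :=
  ⨆ (K : Set X) (_ : IsCompact K) (_ : K ⊆ A), compactCapacity κ K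

/-- `P` holds nearly everywhere on `A`: the set of all `x ∈ A` where `P` fails has inner capacity
zero. -/
def NearlyEverywhere {X : Type*} [TopologicalSpace X] [MeasurableSpace X] (κ : X → X → ℝ≥0∞)
    (A : Set X) (P : X → Prop) : Prop :=
  innerCapacity κ {x | x ∈ A ∧ ¬ P x} = 0

/-- The cone `𝓔⁺(A)` is strongly closed. -/
def StronglyClosed {X : Type*} [TopologicalSpace X] [MeasurableSpace X] (κ : X → X → ℝ≥0∞)
    (A : Set X) : Prop :=
  ∀ (μ : ℕ → Measure X) (ν : Measure X), (∀ n, μ n ∈ finiteEnergyOn κ A) →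
    ν ∈ finiteEnergy κ → StrongTendsto κ μ ν → ν ∈ finiteEnergyOn κ A

/-- The conditions on the measure `ω` that creates the external field `-U^ω`: it is a nonzero
positive Radon measure that either has finite energy, or is bounded with a potential that is bounded
on `A` and upper semicontinuous on every compact subset of `A`. -/
structure AdmissibleCharge {X : Type*} [TopologicalSpace X] [MeasurableSpace X]
    (κ : X → X → ℝ≥0∞) (A : Set X) (ω : Measure X) : Prop where
  radon : IsRadon ω
  ne_zero : ω ≠ 0
  finite_or_bounded : energy κ ω < ∞ ∨
    (ω Set.univ < ∞ ∧
      (∀ K : Set X, IsCompact K → K ⊆ A → UpperSemicontinuousOn (potential κ ω) K) ∧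
      (⨆ x ∈ A, potential κ ω x) < ∞)

/-- `ν` is the inner balayage of `ω` onto `A`: `ν ∈ 𝓔⁺(A)` and `U^ν = U^ω` n.e. on `A`. -/
def IsInnerBalayage {X : Type*} [TopologicalSpace X] [MeasurableSpace X] (κ : X → X → ℝ≥0∞)
    (A : Set X) (ω ν : Measure X) : Prop :=
  ν ∈ finiteEnergyOn κ A ∧ NearlyEverywhere κ A (fun x => potential κ ν x = potential κ ω x)

open Classical in
/-- The inner balayage `ω^A`. -/
def innerBalayage {X : Type*} [TopologicalSpace X] [MeasurableSpace X] (κ : X → X → ℝ≥0∞)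
    (A : Set X) (ω : Measure X) : Measure X :=
  if h : ∃ ν, IsInnerBalayage κ A ω ν then h.choose else 0

/-- `γ` is the inner equilibrium measure on `A`, normalized by `γ(X) = c_*(A)`: it has the least
energy among the measures in `𝓔⁺(A)` of total mass `c_*(A)`. -/
def IsInnerEquilibrium {X : Type*} [TopologicalSpace X] [MeasurableSpace X] (κ : X → X → ℝ≥0∞)
    (A : Set X) (γ : Measure X) : Prop :=
  γ ∈ finiteEnergyOn κ A ∧ γ Set.univ = innerCapacity κ A ∧
    ∀ μ ∈ finiteEnergyOn κ A, μ Set.univ = innerCapacity κ A → energy κ γ ≤ energy κ μ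

open Classical in
/-- The inner equilibrium measure `γ_A` (used if `c_*(A) < ∞`). -/
def innerEquilibrium {X : Type*} [TopologicalSpace X] [MeasurableSpace X] (κ : X → X → ℝ≥0∞)
    (A : Set X) : Measure X :=
  if h : ∃ γ, IsInnerEquilibrium κ A γ then h.choose else 0

/-- The Gauss functional `I_f(μ) = ‖μ‖² - 2 ∫ U^ω dμ`, `f = -U^ω`, for `μ ∈ 𝓔⁺` such that `U^ω` is
`μ`-integrable. -/
def gaussFunctional {X : Type*} [MeasurableSpace X] (κ : X → X → ℝ≥0∞) (ω μ : Measure X) : ℝ :=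
  energyNorm κ μ ^ 2 - 2 * ∫ x, (potential κ ω x).toReal ∂μ

/-- `l` solves the inner Gauss variational problem: it minimizes `I_f` over the measures in `𝓔⁺(A)`
of total mass one. -/
def IsGaussMinimizer {X : Type*} [TopologicalSpace X] [MeasurableSpace X] (κ : X → X → ℝ≥0∞)
    (A : Set X) (ω l : Measure X) : Prop :=
  l ∈ unitFiniteEnergyOn κ A ∧
    ∀ μ ∈ unitFiniteEnergyOn κ A, gaussFunctional κ ω l ≤ gaussFunctional κ ω μ

/-- The `f`-weighted potential `U_f^μ = U^μ - U^ω`. (Where both terms are infinite its value is `⊥`,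
so that it is neither equal to nor at least a real number there.) -/
def weightedPotential {X : Type*} [MeasurableSpace X] (κ : X → X → ℝ≥0∞) (ω μ : Measure X)
    (x : X) : EReal :=
  (potential κ μ x : EReal) - (potential κ ω x : EReal)

/-- The inner `f`-weighted equilibrium constant `c_{A,f} = ∫ U_f^l dl`, where `l` is the solution
to the inner Gauss variational problem. -/
def equilibriumConstant {X : Type*} [MeasurableSpace X] (κ : X → X → ℝ≥0∞) (ω l : Measure X) : ℝ :=
  ∫ x, (weightedPotential κ ω l x).toReal ∂l

/-- The class `Λ_{A,f}` of all `μ ∈ 𝓔⁺` with `U_f^μ ≥ c` n.e. on `A`, for a constant `c`. -/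
def weightedClass {X : Type*} [TopologicalSpace X] [MeasurableSpace X] (κ : X → X → ℝ≥0∞)
    (A : Set X) (ω : Measure X) (c : ℝ) : Set (Measure X) :=
  {μ | μ ∈ finiteEnergy κ ∧ NearlyEverywhere κ A (fun x => (c : EReal) ≤ weightedPotential κ ω μ x)}

end

end Balayage

open Balayage

set_option linter.unusedSectionVars false

namespace Balayage

/-! ### Potentials and mutual energies -/

section Potentials

variable {X : Type*} [TopologicalSpace X] [LocallyCompactSpace X] [T2Space X]
  [SecondCountableTopology X] [MeasurableSpace X] [BorelSpace X] {κ : X → X → ℝ≥0∞}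
  {μ μ' ν ν' τ : Measure X} {A : Set X}

/-! By the energy principle, mutual energy behaves like an inner product, and for measurable
properties "n.e. on `A`" means "a.e. for every measure in `𝓔⁺(A)`" (`nearlyEverywhere_iff`).
Minimizing `‖μ‖² - 2 ∫ g dμ` over the closed cone `𝓔⁺(A)` yields, by the first variation and
domination, a measure with potential `g` n.e. on `A` (`exists_minimizer`; `exists_sweeping` reaches
it through compact subsets). Taking `g = U^ω` gives the balayage `ν`, and `g = 1` the equilibrium
measure `γ`.

Every competitor sees `U^ω` as `U^ν`, so `I_f(μ) = ‖μ - ν‖² - ‖ν‖²`, and `l` is the unit measure on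
`A` nearest to `ν`. If `c_*(A) < ∞`, put `s = (1 - ν(X)) / c_*(A)`: the measure `ν + s γ` has mass
one and exceeds `ν` in potential by the constant `s` n.e. on `A`, hence is the nearest point. If
`c_*(A) = ∞`, unit measures of arbitrarily small energy supply the missing mass at no cost, so `l =
ν`.

In both cases `U_f^l = c ≥ 0` n.e. on `A`. For `μ` in `Λ_{A,f}` this gives `U^l ≤ U^μ` `l`-a.e.,
hence everywhere by domination; integrating, `‖l‖² ≤ I(l, μ) ≤ ‖μ‖²`. Uniqueness is strict positive
definiteness. -/

theorem IsKernel.measurable (hκ : IsKernel κ) : Measurable (fun p : X × X => κ p.1 p.2) :=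
  hκ.lsc.measurable

theorem IsRadon.sigmaFinite (hμ : IsRadon μ) : SigmaFinite μ := by
  have : IsFiniteMeasureOnCompacts μ := hμ
  infer_instance

theorem IsRadon.add (hμ : IsRadon μ) (hν : IsRadon ν) : IsRadon (μ + ν) :=
  ⟨fun K hK => by
    rw [Measure.add_apply]
    exact ENNReal.add_lt_top.2 ⟨hμ.lt_top_of_isCompact hK, hν.lt_top_of_isCompact hK⟩⟩

theorem IsRadon.smul (hμ : IsRadon μ) (t : ℝ≥0) : IsRadon ((t : ℝ≥0∞) • μ) :=
  ⟨fun K hK => by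
    rw [Measure.smul_apply, smul_eq_mul]
    exact ENNReal.mul_lt_top ENNReal.coe_lt_top (hμ.lt_top_of_isCompact hK)⟩

theorem IsRadon.mono (hμ : IsRadon μ) (h : ν ≤ μ) : IsRadon ν :=
  ⟨fun K hK => (h K).trans_lt (hμ.lt_top_of_isCompact hK)⟩

theorem isRadon_zero : IsRadon (0 : Measure X) := ⟨fun K _ => by simp⟩

theorem measurable_potential (hκ : IsKernel κ) (hμ : IsRadon μ) : Measurable (potential κ μ) := by
  have := hμ.sigmaFinite
  exact hκ.measurable.lintegral_prod_right'

theorem lowerSemicontinuous_potential (hκ : IsKernel κ) (μ : Measure X) :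
    LowerSemicontinuous (potential κ μ) := by
  rw [lowerSemicontinuous_iff_le_liminf]
  intro x
  -- Fatou's lemma along the filter `𝓝 x`.
  have hm : ∀ z : X, Measurable (fun y => κ z y) := fun z =>
    hκ.measurable.comp measurable_prodMk_left
  refine le_trans (lintegral_mono fun y => ?_) (lintegral_liminf_le hm)
  have : LowerSemicontinuous (fun z => κ z y) :=
    hκ.lsc.comp (g := fun z : X => (z, y)) (by fun_prop)
  exact this.le_liminf x

theorem mutualEnergy_eq_lintegral (hκ : IsKernel κ) (hν : IsRadon ν) :
    mutualEnergy κ μ ν = ∫⁻ x, potential κ ν x ∂μ := by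
  have := hν.sigmaFinite
  exact lintegral_prod _ hκ.measurable.aemeasurable

theorem mutualEnergy_comm (hκ : IsKernel κ) (hμ : IsRadon μ) (hν : IsRadon ν) :
    mutualEnergy κ μ ν = mutualEnergy κ ν μ := by
  have := hν.sigmaFinite
  have := hμ.sigmaFinite
  unfold mutualEnergy
  rw [← lintegral_prod_swap]
  exact lintegral_congr fun p => hκ.symm _ _

theorem lintegral_potential_comm (hκ : IsKernel κ) (hμ : IsRadon μ) (hν : IsRadon ν) :
    ∫⁻ x, potential κ ν x ∂μ = ∫⁻ x, potential κ μ x ∂ν := by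
  rw [← mutualEnergy_eq_lintegral hκ hν, ← mutualEnergy_eq_lintegral hκ hμ,
    mutualEnergy_comm hκ hμ hν]

theorem potential_add (κ : X → X → ℝ≥0∞) (μ ν : Measure X) (x : X) :
    potential κ (μ + ν) x = potential κ μ x + potential κ ν x :=
  lintegral_add_measure _ _ _

theorem potential_smul (κ : X → X → ℝ≥0∞) (t : ℝ≥0∞) (μ : Measure X) (x : X) :
    potential κ (t • μ) x = t * potential κ μ x :=
  lintegral_smul_measure _ _

theorem mutualEnergy_add_left (hκ : IsKernel κ) (hτ : IsRadon τ) :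
    mutualEnergy κ (μ + ν) τ = mutualEnergy κ μ τ + mutualEnergy κ ν τ := by
  simp only [mutualEnergy_eq_lintegral hκ hτ, lintegral_add_measure]

theorem mutualEnergy_smul_left (hκ : IsKernel κ) (hτ : IsRadon τ) (t : ℝ≥0∞) :
    mutualEnergy κ (t • μ) τ = t * mutualEnergy κ μ τ := by
  simp only [mutualEnergy_eq_lintegral hκ hτ, lintegral_smul_measure, smul_eq_mul]

theorem mutualEnergy_mono (hκ : IsKernel κ) (hμ : IsRadon μ) (hν : IsRadon ν)
    (h : μ' ≤ μ) (h' : ν' ≤ ν) : mutualEnergy κ μ' ν' ≤ mutualEnergy κ μ ν := by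
  have hν' := hν.mono h'
  calc mutualEnergy κ μ' ν' ≤ mutualEnergy κ μ ν' := by
        simp only [mutualEnergy_eq_lintegral hκ hν']
        exact lintegral_mono' h le_rfl
    _ = mutualEnergy κ ν' μ := mutualEnergy_comm hκ hμ hν'
    _ ≤ mutualEnergy κ ν μ := by
        simp only [mutualEnergy_eq_lintegral hκ hμ]
        exact lintegral_mono' h' le_rfl
    _ = mutualEnergy κ μ ν := mutualEnergy_comm hκ hν hμ

theorem mutualEnergy_lt_top (hE : EnergyPrinciple κ) (hμ : μ ∈ finiteEnergy κ)
    (hν : ν ∈ finiteEnergy κ) : mutualEnergy κ μ ν < ∞ := by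
  have h := (hE.nonneg μ ν hμ.1 hν.1).trans_lt (ENNReal.add_lt_top.2 ⟨hμ.2, hν.2⟩)
  by_contra hc
  rw [not_lt, top_le_iff] at hc
  rw [hc, ENNReal.mul_top two_ne_zero] at h
  exact lt_irrefl _ h

theorem add_mem_finiteEnergy (hκ : IsKernel κ) (hE : EnergyPrinciple κ)
    (hμ : μ ∈ finiteEnergy κ) (hν : ν ∈ finiteEnergy κ) : μ + ν ∈ finiteEnergy κ := by
  have hr := hμ.1.add hν.1
  refine ⟨hr, ?_⟩
  unfold energy
  rw [mutualEnergy_add_left hκ hr, mutualEnergy_comm hκ hμ.1 hr, mutualEnergy_comm hκ hν.1 hr,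
    mutualEnergy_add_left hκ hμ.1, mutualEnergy_add_left hκ hν.1]
  simp only [ENNReal.add_lt_top]
  exact ⟨⟨hμ.2, mutualEnergy_lt_top hE hν hμ⟩, mutualEnergy_lt_top hE hμ hν, hν.2⟩

theorem smul_mem_finiteEnergy (hκ : IsKernel κ) (hμ : μ ∈ finiteEnergy κ) (t : ℝ≥0) :
    (t : ℝ≥0∞) • μ ∈ finiteEnergy κ := by
  have hr := hμ.1.smul t
  refine ⟨hr, ?_⟩
  unfold energy
  rw [mutualEnergy_smul_left hκ hr, mutualEnergy_comm hκ hμ.1 hr, mutualEnergy_smul_left hκ hμ.1]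
  exact ENNReal.mul_lt_top ENNReal.coe_lt_top (ENNReal.mul_lt_top ENNReal.coe_lt_top hμ.2)

theorem finiteEnergy_mono (hκ : IsKernel κ) (hμ : μ ∈ finiteEnergy κ) (h : ν ≤ μ) :
    ν ∈ finiteEnergy κ :=
  ⟨hμ.1.mono h, (mutualEnergy_mono hκ hμ.1 hμ.1 h h).trans_lt hμ.2⟩

theorem zero_mem_finiteEnergy : (0 : Measure X) ∈ finiteEnergy κ :=
  ⟨isRadon_zero, by simp [energy, mutualEnergy]⟩

theorem add_mem_finiteEnergyOn (hκ : IsKernel κ) (hE : EnergyPrinciple κ)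
    (hμ : μ ∈ finiteEnergyOn κ A) (hν : ν ∈ finiteEnergyOn κ A) : μ + ν ∈ finiteEnergyOn κ A :=
  ⟨add_mem_finiteEnergy hκ hE hμ.1 hν.1, by simp [hμ.2, hν.2]⟩

theorem smul_mem_finiteEnergyOn (hκ : IsKernel κ) (hμ : μ ∈ finiteEnergyOn κ A) (t : ℝ≥0) :
    (t : ℝ≥0∞) • μ ∈ finiteEnergyOn κ A :=
  ⟨smul_mem_finiteEnergy hκ hμ.1 t, by simp [hμ.2]⟩

theorem finiteEnergyOn_mono (hκ : IsKernel κ) (hμ : μ ∈ finiteEnergyOn κ A) (h : ν ≤ μ) :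
    ν ∈ finiteEnergyOn κ A :=
  ⟨finiteEnergy_mono hκ hμ.1 h, le_antisymm ((h _).trans hμ.2.le) bot_le⟩

theorem finiteEnergyOn_subset {B : Set X} (h : B ⊆ A) :
    finiteEnergyOn κ B ⊆ finiteEnergyOn κ A := fun _ hμ =>
  ⟨hμ.1, measure_mono_null (Set.compl_subset_compl.2 h) hμ.2⟩

theorem zero_mem_finiteEnergyOn : (0 : Measure X) ∈ finiteEnergyOn κ A :=
  ⟨zero_mem_finiteEnergy, by simp⟩

theorem measure_univ_lt_top_of_isCompact {K : Set X} (hK : IsCompact K)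
    (hμ : IsRadon μ) (h : μ Kᶜ = 0) : μ Set.univ < ∞ := by
  rw [← measure_add_measure_compl hK.measurableSet, h, add_zero]
  exact hμ.lt_top_of_isCompact hK

end Potentials

/-! ### The pre-Hilbert structure on measures of finite energy -/

section Pairing

variable {X : Type*} [TopologicalSpace X] [LocallyCompactSpace X] [T2Space X]
  [SecondCountableTopology X] [MeasurableSpace X] [BorelSpace X] {κ : X → X → ℝ≥0∞}
  {μ μ' ν ν' τ : Measure X} {A : Set X}

/-- The mutual energy of two measures of finite energy, as a real number. -/
noncomputable def pairing (κ : X → X → ℝ≥0∞) (μ ν : Measure X) : ℝ := (mutualEnergy κ μ ν).toReal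

theorem pairing_nonneg (κ : X → X → ℝ≥0∞) (μ ν : Measure X) : 0 ≤ pairing κ μ ν :=
  ENNReal.toReal_nonneg

theorem pairing_comm (hκ : IsKernel κ) (hμ : IsRadon μ) (hν : IsRadon ν) :
    pairing κ μ ν = pairing κ ν μ := by
  rw [pairing, mutualEnergy_comm hκ hμ hν, pairing]

theorem pairing_add_left (hκ : IsKernel κ) (hE : EnergyPrinciple κ) (hμ : μ ∈ finiteEnergy κ)
    (hν : ν ∈ finiteEnergy κ) (hτ : τ ∈ finiteEnergy κ) :
    pairing κ (μ + ν) τ = pairing κ μ τ + pairing κ ν τ := by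
  rw [pairing, mutualEnergy_add_left hκ hτ.1, ENNReal.toReal_add
    (mutualEnergy_lt_top hE hμ hτ).ne (mutualEnergy_lt_top hE hν hτ).ne]
  rfl

theorem pairing_smul_left (hκ : IsKernel κ) (hτ : τ ∈ finiteEnergy κ) (t : ℝ≥0) :
    pairing κ ((t : ℝ≥0∞) • μ) τ = t * pairing κ μ τ := by
  rw [pairing, mutualEnergy_smul_left hκ hτ.1, ENNReal.toReal_mul]
  rfl

theorem pairing_add_right (hκ : IsKernel κ) (hE : EnergyPrinciple κ) (hμ : μ ∈ finiteEnergy κ)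
    (hν : ν ∈ finiteEnergy κ) (hτ : τ ∈ finiteEnergy κ) :
    pairing κ τ (μ + ν) = pairing κ τ μ + pairing κ τ ν := by
  rw [pairing_comm hκ hτ.1 (hμ.1.add hν.1), pairing_add_left hκ hE hμ hν hτ,
    pairing_comm hκ hμ.1 hτ.1, pairing_comm hκ hν.1 hτ.1]

theorem pairing_smul_right (hκ : IsKernel κ) (hμ : μ ∈ finiteEnergy κ) (hτ : τ ∈ finiteEnergy κ)
    (t : ℝ≥0) : pairing κ τ ((t : ℝ≥0∞) • μ) = t * pairing κ τ μ := by
  rw [pairing_comm hκ hτ.1 (hμ.1.smul t), pairing_smul_left hκ hτ, pairing_comm hκ hμ.1 hτ.1]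

theorem pairing_add_smul_self (hκ : IsKernel κ) (hE : EnergyPrinciple κ) (hμ : μ ∈ finiteEnergy κ)
    (hν : ν ∈ finiteEnergy κ) (t : ℝ≥0) :
    pairing κ (μ + (t : ℝ≥0∞) • ν) (μ + (t : ℝ≥0∞) • ν) =
      pairing κ μ μ + 2 * t * pairing κ μ ν + t ^ 2 * pairing κ ν ν := by
  have ht := smul_mem_finiteEnergy hκ hν t
  rw [pairing_add_left hκ hE hμ ht (add_mem_finiteEnergy hκ hE hμ ht),
    pairing_add_right hκ hE hμ ht hμ, pairing_add_right hκ hE hμ ht ht,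
    pairing_smul_right hκ hν hμ, pairing_smul_left hκ hμ, pairing_smul_right hκ hν ht,
    pairing_smul_left hκ hν, pairing_comm hκ hν.1 hμ.1]
  ring

theorem pairing_add_self (hκ : IsKernel κ) (hE : EnergyPrinciple κ) (hμ : μ ∈ finiteEnergy κ)
    (hν : ν ∈ finiteEnergy κ) :
    pairing κ (μ + ν) (μ + ν) = pairing κ μ μ + 2 * pairing κ μ ν + pairing κ ν ν := by
  have := pairing_add_smul_self hκ hE hμ hν 1
  simpa using this

theorem pairing_smul_self (hκ : IsKernel κ) (hμ : μ ∈ finiteEnergy κ) (t : ℝ≥0) :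
    pairing κ ((t : ℝ≥0∞) • μ) ((t : ℝ≥0∞) • μ) = t ^ 2 * pairing κ μ μ := by
  rw [pairing_smul_left hκ (smul_mem_finiteEnergy hκ hμ t), pairing_smul_right hκ hμ hμ]
  ring

theorem two_mul_pairing_le (hE : EnergyPrinciple κ) (hμ : μ ∈ finiteEnergy κ)
    (hν : ν ∈ finiteEnergy κ) : 2 * pairing κ μ ν ≤ pairing κ μ μ + pairing κ ν ν := by
  have h := ENNReal.toReal_mono (ENNReal.add_lt_top.2 ⟨hμ.2, hν.2⟩).ne
    (hE.nonneg μ ν hμ.1 hν.1)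
  rw [ENNReal.toReal_mul, ENNReal.toReal_add hμ.2.ne hν.2.ne] at h
  simpa [pairing, energy] using h

theorem eq_of_le_two_mul_pairing (hE : EnergyPrinciple κ) (hμ : μ ∈ finiteEnergy κ)
    (hν : ν ∈ finiteEnergy κ) (h : pairing κ μ μ + pairing κ ν ν ≤ 2 * pairing κ μ ν) :
    μ = ν := by
  refine hE.definite μ ν hμ hν ?_
  have h' := le_antisymm h (two_mul_pairing_le hE hμ hν)
  have hm := mutualEnergy_lt_top hE hμ hν
  rw [← ENNReal.toReal_eq_toReal_iff' (ENNReal.mul_lt_top (by simp) hm).ne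
    (ENNReal.add_lt_top.2 ⟨hμ.2, hν.2⟩).ne, ENNReal.toReal_mul,
    ENNReal.toReal_add hμ.2.ne hν.2.ne]
  simpa [pairing, energy] using h'.symm

/-- The Cauchy–Schwarz inequality for `μ - ν` and `τ`. -/
theorem pairing_sub_sq_le (hκ : IsKernel κ) (hE : EnergyPrinciple κ) (hμ : μ ∈ finiteEnergy κ)
    (hν : ν ∈ finiteEnergy κ) (hτ : τ ∈ finiteEnergy κ) :
    (pairing κ μ τ - pairing κ ν τ) ^ 2 ≤
      (pairing κ μ μ + pairing κ ν ν - 2 * pairing κ μ ν) * pairing κ τ τ := by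
  -- The quadratic is `‖μ - ν + tτ‖²`. For `t < 0` the term `|t|τ` is added to `ν` instead, so that
  -- only positive measures occur.
  have key : ∀ t : ℝ, 0 ≤ pairing κ τ τ * (t * t) + 2 * (pairing κ μ τ - pairing κ ν τ) * t +
      (pairing κ μ μ + pairing κ ν ν - 2 * pairing κ μ ν) := by
    intro t
    rcases le_total 0 t with ht | ht
    · lift t to ℝ≥0 using ht
      have hs := smul_mem_finiteEnergy hκ hτ t
      have h := two_mul_pairing_le hE (add_mem_finiteEnergy hκ hE hμ hs) hν
      rw [pairing_add_smul_self hκ hE hμ hτ, pairing_add_left hκ hE hμ hs hν,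
        pairing_smul_left hκ hν, pairing_comm hκ hτ.1 hν.1] at h
      linarith
    · obtain ⟨s, rfl⟩ : ∃ s, t = -s := ⟨-t, by simp⟩
      have hs' : 0 ≤ s := by linarith
      lift s to ℝ≥0 using hs'
      have hs := smul_mem_finiteEnergy hκ hτ s
      have h := two_mul_pairing_le hE hμ (add_mem_finiteEnergy hκ hE hν hs)
      rw [pairing_add_smul_self hκ hE hν hτ, pairing_add_right hκ hE hν hs hμ,
        pairing_smul_right hκ hτ hμ] at h
      linarith
  have h := discrim_le_zero key
  rw [discrim] at h
  linarith

theorem pairing_sq_le (hκ : IsKernel κ) (hE : EnergyPrinciple κ) (hμ : μ ∈ finiteEnergy κ)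
    (hτ : τ ∈ finiteEnergy κ) : pairing κ μ τ ^ 2 ≤ pairing κ μ μ * pairing κ τ τ := by
  have h := pairing_sub_sq_le hκ hE hμ (ν := 0) zero_mem_finiteEnergy hτ
  have h0 : ∀ σ : Measure X, pairing κ 0 σ = 0 := fun σ => by simp [pairing, mutualEnergy]
  have h1 : pairing κ μ 0 = 0 := by simp [pairing, mutualEnergy]
  simpa [h0, h1] using h

theorem energyDist_sq (hE : EnergyPrinciple κ) (hμ : μ ∈ finiteEnergy κ)
    (hν : ν ∈ finiteEnergy κ) :
    energyDist κ μ ν ^ 2 = pairing κ μ μ + pairing κ ν ν - 2 * pairing κ μ ν :=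
  Real.sq_sqrt (sub_nonneg.2 (two_mul_pairing_le hE hμ hν))

variable {u : ℕ → Measure X}

theorem StrongTendsto.sq (hE : EnergyPrinciple κ) (h : StrongTendsto κ u ν)
    (hu : ∀ n, u n ∈ finiteEnergy κ) (hν : ν ∈ finiteEnergy κ) :
    Tendsto (fun n => pairing κ (u n) (u n) + pairing κ ν ν - 2 * pairing κ (u n) ν) atTop
      (𝓝 0) := by
  have := h.pow 2
  simpa [energyDist_sq hE (hu _) hν] using this

/-- Strong convergence implies weak convergence, by Cauchy–Schwarz applied to `u n - ν` and `τ`. -/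
theorem StrongTendsto.tendsto_pairing (hκ : IsKernel κ) (hE : EnergyPrinciple κ)
    (h : StrongTendsto κ u ν) (hu : ∀ n, u n ∈ finiteEnergy κ) (hν : ν ∈ finiteEnergy κ)
    (hτ : τ ∈ finiteEnergy κ) :
    Tendsto (fun n => pairing κ (u n) τ) atTop (𝓝 (pairing κ ν τ)) := by
  have h1 : Tendsto (fun n => (pairing κ (u n) τ - pairing κ ν τ) ^ 2) atTop (𝓝 0) := by
    refine squeeze_zero (fun n => sq_nonneg _) (fun n => pairing_sub_sq_le hκ hE (hu n) hν hτ) ?_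
    simpa using (h.sq hE hu hν).mul_const (pairing κ τ τ)
  have h2 := h1.sqrt
  simp only [Real.sqrt_sq_eq_abs, Real.sqrt_zero] at h2
  exact tendsto_sub_nhds_zero_iff.1 ((tendsto_zero_iff_abs_tendsto_zero _).2 h2)

theorem StrongTendsto.tendsto_pairing_self (hκ : IsKernel κ) (hE : EnergyPrinciple κ)
    (h : StrongTendsto κ u ν) (hu : ∀ n, u n ∈ finiteEnergy κ) (hν : ν ∈ finiteEnergy κ) :
    Tendsto (fun n => pairing κ (u n) (u n)) atTop (𝓝 (pairing κ ν ν)) := by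
  have h1 := (h.sq hE hu hν).add ((h.tendsto_pairing hκ hE hu hν hν).const_mul 2)
  have h2 := h1.sub_const (pairing κ ν ν)
  convert h2 using 2 <;> ring

end Pairing

/-! ### Inner capacity and exceptional sets -/

section NearlyEverywhere

variable {X : Type*} [TopologicalSpace X] [LocallyCompactSpace X] [T2Space X]
  [SecondCountableTopology X] [MeasurableSpace X] [BorelSpace X] {κ : X → X → ℝ≥0∞}
  {μ ν τ : Measure X} {A K : Set X}

theorem exists_smul_univ_eq_one (h0 : μ Set.univ ≠ 0) (h1 : μ Set.univ ≠ ∞) :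
    ∃ t : ℝ≥0, ((t : ℝ≥0∞) • μ) Set.univ = 1 ∧ (t : ℝ) * (μ Set.univ).toReal = 1 := by
  obtain ⟨m, hm⟩ : ∃ m : ℝ≥0, (m : ℝ≥0∞) = μ Set.univ := ⟨_, ENNReal.coe_toNNReal h1⟩
  have hm0 : m ≠ 0 := by rintro rfl; simp [← hm] at h0
  refine ⟨m⁻¹, ?_, ?_⟩
  · rw [Measure.smul_apply, ← hm, smul_eq_mul, ← ENNReal.coe_mul, inv_mul_cancel₀ hm0,
      ENNReal.coe_one]
  · rw [← hm]
    have : (m : ℝ) ≠ 0 := by exact_mod_cast hm0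
    simp [this]

theorem inv_energy_le_innerCapacity (hK : IsCompact K) (hKA : K ⊆ A)
    (hμ : μ ∈ unitFiniteEnergyOn κ K) : (energy κ μ)⁻¹ ≤ innerCapacity κ A := by
  refine le_trans ?_ (le_iSup₂_of_le K hK (le_iSup_of_le hKA le_rfl))
  refine ENNReal.inv_le_inv.2 ?_
  exact iInf₂_le_of_le μ hμ.1.1.1 (iInf₂_le_of_le hμ.1.2 hμ.2 le_rfl)

theorem exists_energy_lt_of_lt_innerCapacity {r : ℝ≥0∞} (h : r < innerCapacity κ A) :
    ∃ K : Set X, IsCompact K ∧ K ⊆ A ∧ ∃ μ ∈ unitFiniteEnergyOn κ K, energy κ μ < r⁻¹ := by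
  simp only [innerCapacity, lt_iSup_iff] at h
  obtain ⟨K, hK, hKA, h⟩ := h
  rw [compactCapacity, ENNReal.lt_inv_iff_lt_inv] at h
  simp only [iInf_lt_iff] at h
  obtain ⟨μ, h1, h2, h3, h4⟩ := h
  exact ⟨K, hK, hKA, μ, ⟨⟨⟨h1, h4.trans_le le_top⟩, h2⟩, h3⟩, h4⟩

/-- Measures of finite energy on `A` do not charge exceptional sets: otherwise inner regularity
gives a compact subset of positive measure, and the normalized restriction to it is a unit measure
of finite energy. -/
theorem NearlyEverywhere.ae {P : X → Prop} (hκ : IsKernel κ) (h : NearlyEverywhere κ A P)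
    (hP : MeasurableSet {x | P x}) (hμ : μ ∈ finiteEnergyOn κ A) : ∀ᵐ x ∂μ, P x := by
  by_contra hc
  have : IsFiniteMeasureOnCompacts μ := hμ.1.1
  -- `A` need not be measurable; removing a measurable null hull of its complement leaves a Borel
  -- subset of `A`.
  set N := toMeasurable μ Aᶜ
  have hN : μ N = 0 := by rw [measure_toMeasurable, hμ.2]
  have hB : 0 < μ ({x | P x}ᶜ \ N) := by
    rw [measure_sdiff_null hN]
    exact pos_iff_ne_zero.2 hc
  obtain ⟨K, hKB, hK, hpos⟩ :=
    (hP.compl.diff (measurableSet_toMeasurable μ Aᶜ)).exists_lt_isCompact hB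
  have hKA : K ⊆ {x | x ∈ A ∧ ¬ P x} := fun x hx =>
    ⟨by_contra fun hxA => (hKB hx).2 (subset_toMeasurable μ Aᶜ hxA), (hKB hx).1⟩
  have hτ : μ.restrict K ∈ finiteEnergyOn κ K :=
    ⟨finiteEnergy_mono hκ hμ.1 Measure.restrict_le_self, by
      rw [Measure.restrict_apply hK.measurableSet.compl]; simp⟩
  obtain ⟨t, ht, -⟩ := exists_smul_univ_eq_one (μ := μ.restrict K)
    (by simpa using hpos.ne') (by simpa using hK.measure_lt_top.ne)
  have hle := inv_energy_le_innerCapacity hK hKA ⟨smul_mem_finiteEnergyOn hκ hτ t, ht⟩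
  rw [h, le_zero_iff, ENNReal.inv_eq_zero] at hle
  exact (smul_mem_finiteEnergyOn hκ hτ t).1.2.ne hle

theorem nearlyEverywhere_of_forall_ae {P : X → Prop}
    (h : ∀ K : Set X, IsCompact K → K ⊆ A → ∀ μ ∈ finiteEnergyOn κ K, ∀ᵐ x ∂μ, P x) :
    NearlyEverywhere κ A P := by
  rw [NearlyEverywhere]
  by_contra hc
  -- Here `r = 0`: positive inner capacity gives a unit measure of finite energy on a compact subset
  -- of the exceptional set.
  obtain ⟨K, hK, hKA, μ, hμ, -⟩ := exists_energy_lt_of_lt_innerCapacity (pos_iff_ne_zero.2 hc)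
  have h1 := h K hK (fun x hx => (hKA hx).1) μ hμ.1
  have h2 : ∀ᵐ x ∂μ, x ∈ K := hμ.1.2
  have h3 : ∀ᵐ x ∂μ, False := by
    filter_upwards [h1, h2] with x hx hxK
    exact (hKA hxK).2 hx
  have h4 : μ = 0 := by simpa using h3
  have h5 := hμ.2
  simp [h4] at h5

/-- With this, n.e. relations can be combined as a.e. relations, with no subadditivity of inner
capacity. -/
theorem nearlyEverywhere_iff {P : X → Prop} (hκ : IsKernel κ) (hP : MeasurableSet {x | P x}) :
    NearlyEverywhere κ A P ↔ ∀ μ ∈ finiteEnergyOn κ A, ∀ᵐ x ∂μ, P x :=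
  ⟨fun h _ hμ => h.ae hκ hP hμ, fun h => nearlyEverywhere_of_forall_ae fun _ _ hKA μ hμ =>
    h μ (finiteEnergyOn_subset hKA hμ)⟩

/-- After scaling to mass one, this says that unit measures on `K` have energy at least `1 /
c_*(A)`. -/
theorem measure_univ_sq_le (hκ : IsKernel κ) (hc : innerCapacity κ A < ∞) (hK : IsCompact K)
    (hKA : K ⊆ A) (hμ : μ ∈ finiteEnergyOn κ K) :
    (μ Set.univ).toReal ^ 2 ≤ (innerCapacity κ A).toReal * pairing κ μ μ := by
  by_cases h0 : μ Set.univ = 0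
  · rw [h0]
    simpa using mul_nonneg ENNReal.toReal_nonneg (pairing_nonneg κ μ μ)
  have h1 := measure_univ_lt_top_of_isCompact hK hμ.1.1 hμ.2
  obtain ⟨t, ht, ht'⟩ := exists_smul_univ_eq_one h0 h1.ne
  have hτ := smul_mem_finiteEnergyOn hκ hμ t
  have hle := inv_energy_le_innerCapacity hK hKA ⟨hτ, ht⟩
  have hle1 : 1 ≤ innerCapacity κ A * energy κ ((t : ℝ≥0∞) • μ) := by
    by_cases he : energy κ ((t : ℝ≥0∞) • μ) = 0
    · rw [he, ENNReal.inv_zero, top_le_iff] at hle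
      exact absurd hle hc.ne
    · rw [← ENNReal.inv_mul_cancel he hτ.1.2.ne]
      gcongr
  have hle2 := ENNReal.toReal_mono (ENNReal.mul_lt_top hc hτ.1.2).ne hle1
  rw [ENNReal.toReal_mul] at hle2
  have h3 : (energy κ ((t : ℝ≥0∞) • μ)).toReal = t ^ 2 * pairing κ μ μ :=
    pairing_smul_self hκ hμ.1 t
  rw [h3, ENNReal.toReal_one] at hle2
  have hm : 0 ≤ (μ Set.univ).toReal ^ 2 := by positivity
  have := mul_le_mul_of_nonneg_left hle2 hm
  calc (μ Set.univ).toReal ^ 2 = (μ Set.univ).toReal ^ 2 * 1 := by ring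
    _ ≤ _ := this
    _ = ((t : ℝ) * (μ Set.univ).toReal) ^ 2 * ((innerCapacity κ A).toReal * pairing κ μ μ) := by
        ring
    _ = _ := by rw [ht']; ring

end NearlyEverywhere

/-! ### Measures on compact sets and vague convergence -/

section Compact

variable {X : Type*} [TopologicalSpace X] [LocallyCompactSpace X] [T2Space X]
  [SecondCountableTopology X] [MeasurableSpace X] [BorelSpace X] {κ : X → X → ℝ≥0∞}
  {μ ν τ : Measure X} {A K : Set X} {u : ℕ → Measure X}

/-- If `ν` charged a compact set off `K`, a bump function there vanishing on `K` would contradict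
convergence. -/
theorem VagueTendsto.measure_compl_eq_zero (h : VagueTendsto u ν) (hν : IsRadon ν)
    (hK : IsClosed K) (hu : ∀ n, u n Kᶜ = 0) : ν Kᶜ = 0 := by
  by_contra hc
  have : IsFiniteMeasureOnCompacts ν := hν
  obtain ⟨F, hFK, hF, hpos⟩ :=
    hK.isOpen_compl.measurableSet.exists_lt_isCompact (μ := ν) (pos_iff_ne_zero.2 hc)
  obtain ⟨φ, hφ1, hφ0, hφc, hφ⟩ := exists_continuous_one_zero_of_isCompact hF hK
    (Set.disjoint_left.2 fun x hx hxK => hFK hx hxK)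
  have h0 : ∀ n, ∫ x, φ x ∂(u n) = 0 := fun n => by
    refine integral_eq_zero_of_ae ?_
    have : ∀ᵐ x ∂(u n), x ∈ K := hu n
    filter_upwards [this] with x hx using hφ0 hx
  have hlim := h φ φ.continuous hφc
  simp only [h0] at hlim
  have hint : ∫ x, φ x ∂ν = 0 := (tendsto_nhds_unique hlim tendsto_const_nhds)
  have hi : Integrable φ ν := φ.continuous.integrable_of_hasCompactSupport hφc
  rw [integral_eq_zero_iff_of_nonneg (fun x => (hφ x).1) hi] at hint
  have : ν F = 0 := measure_mono_null (fun x hx => by simp [hφ1 hx]) hint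
  exact hpos.ne' this

theorem stronglyClosed_of_isClosed (hC : ConsistencyPrinciple κ) (hK : IsClosed K) :
    StronglyClosed κ K := fun u ν hu hν h =>
  ⟨hν, (hC.finer u ν (fun n => (hu n).1) hν h).measure_compl_eq_zero hν.1 hK fun n => (hu n).2⟩

/-- On a compact set, the total mass is controlled by the energy norm. -/
theorem exists_measure_univ_sq_le (hκ : IsKernel κ)
    (hC : ConsistencyPrinciple κ) (hK : IsCompact K) :
    ∃ b : ℝ, 0 ≤ b ∧
      ∀ μ ∈ finiteEnergyOn κ K, (μ Set.univ).toReal ^ 2 ≤ b * pairing κ μ μ := by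
  by_contra! hcon
  -- If no constant works, normalization gives unit measures on `K` tending strongly, hence vaguely,
  -- to zero; but a test function equal to one on `K` keeps integral one.
  have hex : ∀ n : ℕ, ∃ τ ∈ unitFiniteEnergyOn κ K, pairing κ τ τ ≤ 1 / ((n : ℝ) + 1) := by
    intro n
    obtain ⟨μ, hμ, hlt⟩ := hcon (n + 1) (by positivity)
    have hp := pairing_nonneg κ μ μ
    have h0 : μ Set.univ ≠ 0 := by
      intro h0
      rw [h0] at hlt
      simp only [ENNReal.toReal_zero, ne_eq, OfNat.ofNat_ne_zero, not_false_eq_true,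
        zero_pow] at hlt
      have : 0 ≤ ((n : ℝ) + 1) * pairing κ μ μ := by positivity
      linarith
    have h1 := measure_univ_lt_top_of_isCompact hK hμ.1.1 hμ.2
    obtain ⟨t, ht, ht'⟩ := exists_smul_univ_eq_one h0 h1.ne
    refine ⟨_, ⟨smul_mem_finiteEnergyOn hκ hμ t, ht⟩, ?_⟩
    rw [pairing_smul_self hκ hμ.1, le_div_iff₀ (by positivity)]
    have := mul_le_mul_of_nonneg_left hlt.le (sq_nonneg (t : ℝ))
    calc (t : ℝ) ^ 2 * pairing κ μ μ * (n + 1) = t ^ 2 * ((n + 1) * pairing κ μ μ) := by ring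
      _ ≤ _ := this
      _ = (t * (μ Set.univ).toReal) ^ 2 := by ring
      _ = 1 := by rw [ht']; ring
  choose u hu hle using hex
  have hs : StrongTendsto κ u 0 := by
    have h1 : Tendsto (fun n : ℕ => √(1 / ((n : ℝ) + 1))) atTop (𝓝 0) := by
      simpa using tendsto_one_div_add_atTop_nhds_zero_nat.sqrt
    refine squeeze_zero (fun n => Real.sqrt_nonneg _) (fun n => Real.sqrt_le_sqrt ?_) h1
    have := hle n
    simpa [energy, mutualEnergy, pairing] using this
  have hv := hC.finer u 0 (fun n => (hu n).1.1) zero_mem_finiteEnergy hs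
  obtain ⟨φ, hφ1, -, hφc, -⟩ := exists_continuous_one_zero_of_isCompact hK isClosed_empty
    (Set.disjoint_empty K)
  have h1 : ∀ n, ∫ x, φ x ∂(u n) = 1 := fun n => by
    have hK' : ∀ᵐ x ∂(u n), x ∈ K := (hu n).1.2
    rw [integral_congr_ae (g := fun _ => (1 : ℝ))
      (by filter_upwards [hK'] with x hx using hφ1 hx)]
    simp [Measure.real, (hu n).2]
  have := hv φ φ.continuous hφc
  simp only [h1, integral_zero_measure] at this
  exact one_ne_zero (tendsto_nhds_unique tendsto_const_nhds this)

/-- Vague convergence of measures on a compact set can be tested on functions that are continuous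
on that set. -/
theorem VagueTendsto.tendsto_lintegral (h : VagueTendsto u ν) (hK : IsCompact K)
    (hu : ∀ n, u n Kᶜ = 0) (hν : ν Kᶜ = 0) {g : X → ℝ≥0∞} (hgm : Measurable g)
    (hg : ContinuousOn g K) (hg' : ∀ x ∈ K, g x ≠ ∞) :
    Tendsto (fun n => (∫⁻ x, g x ∂(u n)).toReal) atTop (𝓝 (∫⁻ x, g x ∂ν).toReal) := by
  have hr : ContinuousOn (fun x => (g x).toReal) K :=
    ENNReal.continuousOn_toReal.comp hg fun x hx => hg' x hx
  -- Tietze extends `g` from `K`; the cutoff `χ` makes the support compact.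
  obtain ⟨ψ, hψ⟩ := ContinuousMap.exists_restrict_eq hK.isClosed
    (⟨_, hr.domRestrict⟩ : C(K, ℝ))
  have hψ' : ∀ x ∈ K, ψ x = (g x).toReal := fun x hx => DFunLike.congr_fun hψ ⟨x, hx⟩
  obtain ⟨χ, hχ1, -, hχc, -⟩ := exists_continuous_one_zero_of_isCompact hK isClosed_empty
    (Set.disjoint_empty K)
  have key : ∀ σ : Measure X, σ Kᶜ = 0 →
      ∫ x, ψ x * χ x ∂σ = (∫⁻ x, g x ∂σ).toReal := by
    intro σ hσ
    have hσ' : ∀ᵐ x ∂σ, x ∈ K := hσ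
    rw [← integral_toReal hgm.aemeasurable
      (by filter_upwards [hσ'] with x hx using lt_top_iff_ne_top.2 (hg' x hx))]
    refine integral_congr_ae ?_
    filter_upwards [hσ'] with x hx
    rw [hψ' x hx, hχ1 hx]
    simp
  have := h (fun x => ψ x * χ x) (ψ.continuous.mul χ.continuous) (hχc.mul_left (f := ψ))
  simpa only [key _ (hu _), key _ hν] using this

end Compact

/-! ### Minimizing `‖μ‖² - 2 ∫ g dμ` over cones -/

section Minimization

variable {X : Type*} [TopologicalSpace X] [LocallyCompactSpace X] [T2Space X]
  [SecondCountableTopology X] [MeasurableSpace X] [BorelSpace X] {κ : X → X → ℝ≥0∞}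
  {μ ν τ : Measure X} {A K : Set X} {u : ℕ → Measure X} {g : X → ℝ≥0∞} {C : Set (Measure X)}
  {v : ℝ}

/-- A convex cone of measures of finite energy, all of which integrate the function `g`. -/
structure IsEnergyCone (κ : X → X → ℝ≥0∞) (g : X → ℝ≥0∞) (C : Set (Measure X)) : Prop where
  subset : C ⊆ finiteEnergy κ
  zero_mem : 0 ∈ C
  add_mem : ∀ μ ∈ C, ∀ ν ∈ C, μ + ν ∈ C
  smul_mem : ∀ μ ∈ C, ∀ t : ℝ≥0, (t : ℝ≥0∞) • μ ∈ C
  lintegral_lt_top : ∀ μ ∈ C, ∫⁻ x, g x ∂μ < ∞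

/-- The functional `‖μ‖² - 2 ∫ g dμ`. -/
noncomputable def quadraticFunctional (κ : X → X → ℝ≥0∞) (g : X → ℝ≥0∞) (μ : Measure X) : ℝ :=
  pairing κ μ μ - 2 * (∫⁻ x, g x ∂μ).toReal

theorem IsEnergyCone.toReal_lintegral_add (hc : IsEnergyCone κ g C) (hμ : μ ∈ C) (hν : ν ∈ C) :
    (∫⁻ x, g x ∂(μ + ν)).toReal = (∫⁻ x, g x ∂μ).toReal + (∫⁻ x, g x ∂ν).toReal := by
  rw [lintegral_add_measure, ENNReal.toReal_add (hc.lintegral_lt_top μ hμ).ne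
    (hc.lintegral_lt_top ν hν).ne]

theorem toReal_lintegral_smul (g : X → ℝ≥0∞) (μ : Measure X) (t : ℝ≥0) :
    (∫⁻ x, g x ∂((t : ℝ≥0∞) • μ)).toReal = t * (∫⁻ x, g x ∂μ).toReal := by
  rw [lintegral_smul_measure, smul_eq_mul, ENNReal.toReal_mul]
  rfl

theorem IsEnergyCone.exists_seq_tendsto (hc : IsEnergyCone κ g C) {b : ℝ}
    (hb : ∀ μ ∈ C, b ≤ quadraticFunctional κ g μ) :
    ∃ (u : ℕ → Measure X) (v : ℝ), (∀ n, u n ∈ C) ∧ (∀ μ ∈ C, v ≤ quadraticFunctional κ g μ) ∧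
      Tendsto (fun n => quadraticFunctional κ g (u n)) atTop (𝓝 v) := by
  have hbdd : BddBelow (quadraticFunctional κ g '' C) :=
    ⟨b, by rintro _ ⟨μ, hμ, rfl⟩; exact hb μ hμ⟩
  obtain ⟨w, -, hw, hw'⟩ := exists_seq_tendsto_sInf
    (⟨_, 0, hc.zero_mem, rfl⟩ : (quadraticFunctional κ g '' C).Nonempty) hbdd
  choose u hu hu' using hw'
  refine ⟨u, _, hu, fun μ hμ => csInf_le hbdd ⟨μ, hμ, rfl⟩, ?_⟩
  simpa only [hu'] using hw

/-- Parallelogram law: the midpoint of `u m` and `u n` is in the cone, so `‖u m - u n‖² ≤ 2 J(u m) +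
2 J(u n) - 4 v` for the functional `J`. -/
theorem IsEnergyCone.strongCauchySeq (hκ : IsKernel κ) (hE : EnergyPrinciple κ)
    (hc : IsEnergyCone κ g C) (hu : ∀ n, u n ∈ C) (hv : ∀ μ ∈ C, v ≤ quadraticFunctional κ g μ)
    (h : Tendsto (fun n => quadraticFunctional κ g (u n)) atTop (𝓝 v)) :
    StrongCauchySeq κ u := by
  intro ε hε
  have hev := h.eventually_lt_const (show v < v + ε ^ 2 / 4 by
    have : 0 < ε ^ 2 := by positivity
    linarith)
  obtain ⟨N, hN⟩ := eventually_atTop.1 hev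
  refine ⟨N, fun m hm n hn => ?_⟩
  have hm' := hN m hm
  have hn' := hN n hn
  have hmn := hv _ (hc.smul_mem _ (hc.add_mem _ (hu m) _ (hu n)) (1 / 2))
  have e := pairing_add_self hκ hE (hc.subset (hu m)) (hc.subset (hu n))
  unfold quadraticFunctional at hm' hn' hmn
  rw [toReal_lintegral_smul, hc.toReal_lintegral_add (hu m) (hu n), pairing_smul_self hκ
    (hc.subset (hc.add_mem _ (hu m) _ (hu n))), e] at hmn
  push_cast at hmn
  refine (Real.sqrt_lt' hε).2 ?_
  change pairing κ (u m) (u m) + pairing κ (u n) (u n) - 2 * pairing κ (u m) (u n) < ε ^ 2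
  linarith

/-- First variation: compare `v` with the value at `u n + t μ`, let `n → ∞`, divide by `2t`, and let
`t → 0`. The limit `ν` need not lie in the cone, which matters in `exists_sweeping`. -/
theorem IsEnergyCone.toReal_lintegral_le (hκ : IsKernel κ) (hE : EnergyPrinciple κ)
    (hc : IsEnergyCone κ g C) (hu : ∀ n, u n ∈ C) (hv : ∀ μ ∈ C, v ≤ quadraticFunctional κ g μ)
    (h : Tendsto (fun n => quadraticFunctional κ g (u n)) atTop (𝓝 v))
    (hν : ν ∈ finiteEnergy κ) (hs : StrongTendsto κ u ν) (hμ : μ ∈ C) :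
    (∫⁻ x, g x ∂μ).toReal ≤ pairing κ ν μ := by
  have hμ' := hc.subset hμ
  have key : ∀ t : ℝ≥0, 0 < t →
      (∫⁻ x, g x ∂μ).toReal ≤ pairing κ ν μ + t * (pairing κ μ μ / 2) := by
    intro t ht
    have h1 : ∀ n, v ≤ quadraticFunctional κ g (u n) +
        (2 * t * pairing κ (u n) μ + t ^ 2 * pairing κ μ μ
          - 2 * t * (∫⁻ x, g x ∂μ).toReal) := by
      intro n
      have hs := hc.smul_mem μ hμ t
      have := hv _ (hc.add_mem _ (hu n) _ hs)
      unfold quadraticFunctional at this ⊢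
      rw [pairing_add_smul_self hκ hE (hc.subset (hu n)) hμ',
        hc.toReal_lintegral_add (hu n) hs, toReal_lintegral_smul] at this
      linarith
    have h2 := ((hs.tendsto_pairing hκ hE (fun n => hc.subset (hu n)) hν hμ').const_mul
      (2 * (t : ℝ)))
    have h3 := h.add ((h2.add_const ((t : ℝ) ^ 2 * pairing κ μ μ)).sub_const
      (2 * t * (∫⁻ x, g x ∂μ).toReal))
    have h4 := ge_of_tendsto' h3 h1
    have ht' : (0 : ℝ) < t := ht
    have h5 : (t : ℝ) * (2 * (∫⁻ x, g x ∂μ).toReal) ≤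
        t * (2 * pairing κ ν μ + t * pairing κ μ μ) := by linarith
    have := le_of_mul_le_mul_left h5 ht'
    linarith
  have hp := pairing_nonneg κ μ μ
  refine le_of_forall_pos_le_add fun ε hε => ?_
  have hδ : 0 < ε / (pairing κ μ μ / 2 + 1) := by positivity
  have := key (NNReal.mk _ hδ.le) hδ
  refine this.trans (add_le_add le_rfl ?_)
  rw [NNReal.coe_mk, div_mul_eq_mul_div, div_le_iff₀ (by positivity)]
  nlinarith

/-- Comparison of `g` with a potential almost everywhere from a comparison of integrals. -/
theorem ae_le_potential_of_forall (hκ : IsKernel κ) (hE : EnergyPrinciple κ) (hgm : Measurable g)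
    (hν : ν ∈ finiteEnergy κ) (hμ : μ ∈ finiteEnergyOn κ A)
    (hfin : ∫⁻ x, g x ∂μ < ∞)
    (h : ∀ τ ∈ finiteEnergyOn κ A, τ ≤ μ → (∫⁻ x, g x ∂τ).toReal ≤ pairing κ ν τ) :
    ∀ᵐ x ∂μ, g x ≤ potential κ ν x := by
  have := hμ.1.1.sigmaFinite
  -- The test measures are the restrictions of `μ` to measurable sets.
  refine ae_le_of_forall_setLIntegral_le_of_sigmaFinite hgm fun s _ _ => ?_
  have hτ := finiteEnergyOn_mono hκ hμ (Measure.restrict_le_self (s := s))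
  have h1 := h _ hτ Measure.restrict_le_self
  rw [← mutualEnergy_eq_lintegral hκ hν.1, mutualEnergy_comm hκ hτ.1.1 hν.1]
  exact (ENNReal.toReal_le_toReal ((setLIntegral_le_lintegral _ _).trans_lt hfin).ne
    (mutualEnergy_lt_top hE hν hτ.1).ne).1 h1

theorem ae_potential_le_of_forall (hκ : IsKernel κ) (hE : EnergyPrinciple κ)
    (hν : ν ∈ finiteEnergy κ) (hμ : μ ∈ finiteEnergyOn κ A)
    (hfin : ∫⁻ x, g x ∂μ < ∞)
    (h : ∀ τ ∈ finiteEnergyOn κ A, τ ≤ μ → pairing κ ν τ ≤ (∫⁻ x, g x ∂τ).toReal) :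
    ∀ᵐ x ∂μ, potential κ ν x ≤ g x := by
  have := hμ.1.1.sigmaFinite
  refine ae_le_of_forall_setLIntegral_le_of_sigmaFinite (measurable_potential hκ hν.1)
    fun s _ _ => ?_
  have hτ := finiteEnergyOn_mono hκ hμ (Measure.restrict_le_self (s := s))
  have h1 := h _ hτ Measure.restrict_le_self
  rw [← mutualEnergy_eq_lintegral hκ hν.1, mutualEnergy_comm hκ hτ.1.1 hν.1]
  exact (ENNReal.toReal_le_toReal (mutualEnergy_lt_top hE hν hτ.1).ne
    ((setLIntegral_le_lintegral _ _).trans_lt hfin).ne).1 h1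

/-- The function `g` dominates every potential of a measure `μ` of finite energy that it dominates
`μ`-almost everywhere. -/
def Dominates (κ : X → X → ℝ≥0∞) (g : X → ℝ≥0∞) : Prop :=
  ∀ μ ∈ finiteEnergy κ, (∀ᵐ x ∂μ, potential κ μ x ≤ g x) → ∀ x, potential κ μ x ≤ g x

/-- The minimizer of the functional `‖μ‖² - 2 ∫ g dμ` over a strongly closed cone. -/
theorem exists_minimizer (hκ : IsKernel κ) (hE : EnergyPrinciple κ) (hC : ConsistencyPrinciple κ)
    (hcl : StronglyClosed κ A) (hgm : Measurable g) (hg : Dominates κ g)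
    (hfin : ∀ μ ∈ finiteEnergyOn κ A, ∫⁻ x, g x ∂μ < ∞)
    {b : ℝ} (hb : ∀ μ ∈ finiteEnergyOn κ A, b ≤ quadraticFunctional κ g μ)
    (hcont : ∀ (u : ℕ → Measure X) (ν : Measure X), (∀ n, u n ∈ finiteEnergyOn κ A) →
      ν ∈ finiteEnergyOn κ A → StrongTendsto κ u ν →
      Tendsto (fun n => (∫⁻ x, g x ∂(u n)).toReal) atTop (𝓝 (∫⁻ x, g x ∂ν).toReal)) :
    ∃ ν ∈ finiteEnergyOn κ A,
      (∀ μ ∈ finiteEnergyOn κ A, quadraticFunctional κ g ν ≤ quadraticFunctional κ g μ) ∧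
      (∀ μ ∈ finiteEnergyOn κ A, ∀ᵐ x ∂μ, potential κ ν x = g x) ∧
      ∀ x, potential κ ν x ≤ g x := by
  have hc : IsEnergyCone κ g (finiteEnergyOn κ A) :=
    ⟨fun μ hμ => hμ.1, zero_mem_finiteEnergyOn, fun μ hμ ν hν => add_mem_finiteEnergyOn hκ hE hμ hν,
      fun μ hμ t => smul_mem_finiteEnergyOn hκ hμ t, hfin⟩
  obtain ⟨u, v, hu, hv, hlim⟩ := hc.exists_seq_tendsto hb
  obtain ⟨ν, hν, hs⟩ := hC.complete u (fun n => (hu n).1)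
    (hc.strongCauchySeq hκ hE hu hv hlim)
  have hνA := hcl u ν hu hν hs
  have hle := fun μ hμ => hc.toReal_lintegral_le (μ := μ) hκ hE hu hv hlim hν hs hμ
  have hJ : quadraticFunctional κ g ν = v := by
    refine tendsto_nhds_unique ?_ hlim
    exact (hs.tendsto_pairing_self hκ hE (fun n => (hu n).1) hν).sub
      ((hcont u ν hu hνA hs).const_mul 2)
  have hmin : ∀ μ ∈ finiteEnergyOn κ A, quadraticFunctional κ g ν ≤ quadraticFunctional κ g μ :=
    fun μ hμ => hJ ▸ hv μ hμ
  have hge : ∀ μ ∈ finiteEnergyOn κ A, ∀ᵐ x ∂μ, g x ≤ potential κ ν x := fun μ hμ =>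
    ae_le_potential_of_forall hκ hE hgm hν hμ (hfin μ hμ) fun τ hτ _ => hle τ hτ
  -- The cone contains every `t ν`. The best factor `t = G / e` gives `e - 2G ≤ -G² / e`, that is,
  -- `(e - G)² ≤ 0`.
  have hself : pairing κ ν ν ≤ (∫⁻ x, g x ∂ν).toReal := by
    set e := pairing κ ν ν with he
    set G := (∫⁻ x, g x ∂ν).toReal with hG
    have he0 : 0 ≤ e := pairing_nonneg κ ν ν
    have hG0 : 0 ≤ G := ENNReal.toReal_nonneg
    have h1 : ∀ t : ℝ≥0, e - 2 * G ≤ t ^ 2 * e - 2 * (t * G) := fun t => by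
      have := hmin _ (smul_mem_finiteEnergyOn hκ hνA t)
      unfold quadraticFunctional at this
      rwa [pairing_smul_self hκ hν, toReal_lintegral_smul] at this
    rcases he0.eq_or_lt with h0 | h0
    · rw [← h0]; exact hG0
    · have h2 := h1 (NNReal.mk (G / e) (by positivity))
      rw [NNReal.coe_mk] at h2
      have h3 : (G / e) ^ 2 * e - 2 * (G / e * G) = -(G ^ 2 / e) := by field_simp; ring
      rw [h3, le_neg, div_le_iff₀ h0] at h2
      nlinarith [sq_nonneg (e - G)]
  -- Since `g ≤ U^ν` `ν`-a.e. and the integrals are ordered the other way, equality holds `ν`-a.e.;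
  -- `Dominates` then extends `U^ν ≤ g` to all of `X`.
  have hνae : ∀ᵐ x ∂ν, potential κ ν x ≤ g x := by
    have h1 : ∫⁻ x, potential κ ν x ∂ν ≤ ∫⁻ x, g x ∂ν := by
      rw [← mutualEnergy_eq_lintegral hκ hν.1]
      exact (ENNReal.toReal_le_toReal hν.2.ne (hfin ν hνA).ne).1 hself
    have h2 := ae_eq_of_ae_le_of_lintegral_le (hge ν hνA) (hfin ν hνA).ne
      (measurable_potential hκ hν.1).aemeasurable h1
    filter_upwards [h2] with x hx using hx.ge
  have hle' := hg ν hν hνae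
  refine ⟨ν, hνA, hmin, fun μ hμ => ?_, hle'⟩
  filter_upwards [hge μ hμ] with x hx using le_antisymm (hle' x) hx

/-- The mass bound on `K` gives `2 ∫ g dμ ≤ 2M√b ‖μ‖ ≤ M²b + ‖μ‖²`, so the functional is bounded
below; continuity of `g` on `K` makes `∫ g` strongly continuous through vague convergence. -/
theorem exists_minimizer_of_isCompact (hκ : IsKernel κ) (hE : EnergyPrinciple κ)
    (hC : ConsistencyPrinciple κ) (hK : IsCompact K) (hgm : Measurable g) (hg : Dominates κ g)
    (hgK : ContinuousOn g K) {M : ℝ≥0} (hM : ∀ x ∈ K, g x ≤ M) :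
    ∃ ν ∈ finiteEnergyOn κ K,
      (∀ μ ∈ finiteEnergyOn κ K, quadraticFunctional κ g ν ≤ quadraticFunctional κ g μ) ∧
      (∀ μ ∈ finiteEnergyOn κ K, ∀ᵐ x ∂μ, potential κ ν x = g x) ∧
      ∀ x, potential κ ν x ≤ g x := by
  obtain ⟨b, hb0, hb⟩ := exists_measure_univ_sq_le hκ hC hK
  have hle : ∀ μ ∈ finiteEnergyOn κ K, ∫⁻ x, g x ∂μ ≤ M * μ Set.univ := fun μ hμ => by
    have hK' : ∀ᵐ x ∂μ, x ∈ K := hμ.2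
    rw [← lintegral_const]
    exact lintegral_mono_ae (by filter_upwards [hK'] with x hx using hM x hx)
  have hlt : ∀ μ ∈ finiteEnergyOn κ K, (M : ℝ≥0∞) * μ Set.univ < ∞ := fun μ hμ =>
    ENNReal.mul_lt_top ENNReal.coe_lt_top (measure_univ_lt_top_of_isCompact hK hμ.1.1 hμ.2)
  have hcl := stronglyClosed_of_isClosed hC hK.isClosed
  refine exists_minimizer hκ hE hC hcl hgm hg
    (fun μ hμ => (hle μ hμ).trans_lt (hlt μ hμ)) (b := -(M ^ 2 * b)) (fun μ hμ => ?_)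
    fun u ν hu hν hs => ?_
  · have h1 := ENNReal.toReal_mono (hlt μ hμ).ne (hle μ hμ)
    rw [ENNReal.toReal_mul, ENNReal.coe_toReal] at h1
    have h2 := hb μ hμ
    have hp := pairing_nonneg κ μ μ
    set m := (μ Set.univ).toReal
    have hm : 0 ≤ m := ENNReal.toReal_nonneg
    have hM0 : (0 : ℝ) ≤ M := M.2
    unfold quadraticFunctional
    have h3 : 2 * (M * m) ≤ M ^ 2 * b + pairing κ μ μ := by
      have h4 : (M * m) ^ 2 ≤ M ^ 2 * b * pairing κ μ μ := by
        rw [mul_pow, mul_assoc]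
        gcongr
      have h5 : (2 * (M * m)) ^ 2 ≤ (M ^ 2 * b + pairing κ μ μ) ^ 2 := by
        nlinarith [sq_nonneg (M ^ 2 * b - pairing κ μ μ)]
      exact le_of_sq_le_sq h5 (by positivity)
    linarith
  · exact (hC.finer u ν (fun n => (hu n).1) hν.1 hs).tendsto_lintegral hK (fun n => (hu n).2)
      hν.2 hgm hgK fun x hx => ((hM x hx).trans_lt ENNReal.coe_lt_top).ne

/-- Sweeping a function `g` out onto a strongly closed set `A`, given a bound for the energies of
the measures obtained for the compact subsets of `A`. -/
theorem exists_sweeping (hκ : IsKernel κ) (hE : EnergyPrinciple κ)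
    (hC : ConsistencyPrinciple κ) (hcl : StronglyClosed κ A) (hgm : Measurable g)
    (hg : Dominates κ g) (hgK : ∀ K : Set X, IsCompact K → K ⊆ A → ContinuousOn g K)
    {M : ℝ≥0} (hM : ∀ x ∈ A, g x ≤ M) {B : ℝ}
    (hB : ∀ K : Set X, IsCompact K → K ⊆ A → ∀ μ ∈ finiteEnergyOn κ K,
      (∀ᵐ x ∂μ, potential κ μ x = g x) → (∀ x, potential κ μ x ≤ g x) → pairing κ μ μ ≤ B) :
    ∃ ν ∈ finiteEnergyOn κ A, NearlyEverywhere κ A (fun x => potential κ ν x = g x) ∧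
      pairing κ ν ν ≤ B := by
  -- Measures carried by compact subsets of `A` integrate `g`. This cone need not be strongly
  -- closed; only the limit is placed in `𝓔⁺(A)`.
  set C : Set (Measure X) := {μ | ∃ K : Set X, IsCompact K ∧ K ⊆ A ∧ μ ∈ finiteEnergyOn κ K}
  have hCA : C ⊆ finiteEnergyOn κ A := fun μ ⟨K, _, hKA, hμ⟩ => finiteEnergyOn_subset hKA hμ
  have hc : IsEnergyCone κ g C := by
    refine ⟨fun μ hμ => (hCA hμ).1,
      ⟨∅, isCompact_empty, Set.empty_subset _, zero_mem_finiteEnergyOn⟩, ?_, ?_, ?_⟩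
    · rintro μ ⟨K, hK, hKA, hμ⟩ ν ⟨K', hK', hKA', hν⟩
      exact ⟨K ∪ K', hK.union hK', Set.union_subset hKA hKA', add_mem_finiteEnergyOn hκ hE
        (finiteEnergyOn_subset Set.subset_union_left hμ)
        (finiteEnergyOn_subset Set.subset_union_right hν)⟩
    · rintro μ ⟨K, hK, hKA, hμ⟩ t
      exact ⟨K, hK, hKA, smul_mem_finiteEnergyOn hκ hμ t⟩
    · rintro μ ⟨K, hK, hKA, hμ⟩
      have hK' : ∀ᵐ x ∂μ, x ∈ K := hμ.2
      calc ∫⁻ x, g x ∂μ ≤ ∫⁻ _, M ∂μ :=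
            lintegral_mono_ae (by filter_upwards [hK'] with x hx using hM x (hKA hx))
        _ = M * μ Set.univ := lintegral_const _
        _ < ∞ := ENNReal.mul_lt_top ENNReal.coe_lt_top
            (measure_univ_lt_top_of_isCompact hK hμ.1.1 hμ.2)
  -- Replace a competitor by the minimizer on its compact set, where the functional equals `-‖ν‖² ≥
  -- -B`. The improved minimizing sequence also satisfies `U^(u n) ≤ g`.
  have hmin : ∀ μ ∈ C, ∃ ν ∈ C, quadraticFunctional κ g ν ≤ quadraticFunctional κ g μ ∧
      quadraticFunctional κ g ν = - pairing κ ν ν ∧ pairing κ ν ν ≤ B ∧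
      ∀ x, potential κ ν x ≤ g x := by
    rintro μ ⟨K, hK, hKA, hμ⟩
    obtain ⟨ν, hν, h1, h2, h3⟩ := exists_minimizer_of_isCompact hκ hE hC hK hgm hg
      (hgK K hK hKA) (fun x hx => hM x (hKA hx))
    refine ⟨ν, ⟨K, hK, hKA, hν⟩, h1 μ hμ, ?_, hB K hK hKA ν hν (h2 ν hν) h3, h3⟩
    rw [quadraticFunctional, ← lintegral_congr_ae (h2 ν hν),
      ← mutualEnergy_eq_lintegral hκ hν.1.1]
    change pairing κ ν ν - 2 * pairing κ ν ν = _
    ring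
  have hb : ∀ μ ∈ C, -B ≤ quadraticFunctional κ g μ := fun μ hμ => by
    obtain ⟨ν, -, h1, h2, h3, -⟩ := hmin μ hμ
    linarith
  obtain ⟨w, v, hw, hv, hwlim⟩ := hc.exists_seq_tendsto hb
  choose u hu huw huJ huB hug using fun n => hmin (w n) (hw n)
  have hlim : Tendsto (fun n => quadraticFunctional κ g (u n)) atTop (𝓝 v) :=
    tendsto_of_tendsto_of_tendsto_of_le_of_le tendsto_const_nhds hwlim
      (fun n => hv _ (hu n)) huw
  have huE : ∀ n, u n ∈ finiteEnergy κ := fun n => (hCA (hu n)).1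
  obtain ⟨ν, hν, hs⟩ := hC.complete u huE (hc.strongCauchySeq hκ hE hu hv hlim)
  refine ⟨ν, hcl u ν (fun n => hCA (hu n)) hν hs, ?_,
    le_of_tendsto' (hs.tendsto_pairing_self hκ hE huE hν) huB⟩
  refine nearlyEverywhere_of_forall_ae fun K hK hKA μ hμ => ?_
  have hfin := fun (τ : Measure X) (hτ : τ ∈ finiteEnergyOn κ K) =>
    hc.lintegral_lt_top τ ⟨K, hK, hKA, hτ⟩
  -- The lower bound is the first variation; the upper bound is `U^(u n) ≤ g` integrated against `τ`
  -- and passed to the limit.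
  filter_upwards [ae_le_potential_of_forall hκ hE hgm hν hμ (hfin μ hμ) fun τ hτ _ =>
      hc.toReal_lintegral_le hκ hE hu hv hlim hν hs ⟨K, hK, hKA, hτ⟩,
    ae_potential_le_of_forall hκ hE hν hμ (hfin μ hμ) fun τ hτ _ => by
      refine le_of_tendsto' (hs.tendsto_pairing hκ hE huE hν hτ.1) fun n => ?_
      refine ENNReal.toReal_mono (hfin τ hτ).ne ?_
      rw [mutualEnergy_comm hκ (huE n).1 hτ.1.1, mutualEnergy_eq_lintegral hκ (huE n).1]
      exact lintegral_mono (hug n)] with x h1 h2 using le_antisymm h2 h1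

end Minimization

/-! ### Existence of the equilibrium measure and the balayage -/

section Existence

variable {X : Type*} [TopologicalSpace X] [LocallyCompactSpace X] [T2Space X]
  [SecondCountableTopology X] [MeasurableSpace X] [BorelSpace X] {κ : X → X → ℝ≥0∞}
  {μ ν τ γ ω l : Measure X} {A K : Set X}

theorem DominationPrinciple.dominates (hD : DominationPrinciple κ) (hω : IsRadon ω) :
    Dominates κ (potential κ ω) := fun μ hμ h => hD μ ω hμ hω h

theorem FrostmanPrinciple.dominates_one (hF : FrostmanPrinciple κ) :
    Dominates κ (fun _ => 1) := fun μ hμ h => by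
  simpa using hF μ hμ 1 one_pos (by simpa using h)

theorem exists_equilibrium (hκ : IsKernel κ) (hE : EnergyPrinciple κ)
    (hC : ConsistencyPrinciple κ) (hF : FrostmanPrinciple κ) (hcl : StronglyClosed κ A)
    (hfin : innerCapacity κ A < ∞) :
    ∃ γ ∈ finiteEnergyOn κ A, NearlyEverywhere κ A (fun x => potential κ γ x = 1) ∧
      γ Set.univ = innerCapacity κ A := by
  have hself : ∀ μ : Measure X, IsRadon μ → (∀ᵐ x ∂μ, potential κ μ x = 1) →
      energy κ μ = μ Set.univ := fun μ hμ h => by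
    rw [energy, mutualEnergy_eq_lintegral hκ hμ, lintegral_congr_ae h, lintegral_one]
  obtain ⟨γ, hγ, hne, hle⟩ := exists_sweeping hκ hE hC hcl measurable_const hF.dominates_one
    (fun K _ _ => continuousOn_const) (M := 1) (fun x _ => le_rfl)
    -- For the compact minimizers `‖μ‖² = μ(X)`, so `μ(X)² ≤ c_*(A) ‖μ‖²` gives `‖μ‖² ≤ c_*(A)`.
    (B := (innerCapacity κ A).toReal) (fun K hK hKA μ hμ h1 _ => by
      have h2 := measure_univ_sq_le hκ hfin hK hKA hμ
      have h3 : pairing κ μ μ = (μ Set.univ).toReal :=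
        congrArg ENNReal.toReal (hself μ hμ.1.1 h1)
      rw [← h3, sq] at h2
      rcases (pairing_nonneg κ μ μ).eq_or_lt with h0 | h0
      · rw [← h0]; exact ENNReal.toReal_nonneg
      · exact le_of_mul_le_mul_right h2 h0)
  have hγae := fun {μ} hμ => hne.ae (μ := μ) hκ
    (measurableSet_eq_fun (measurable_potential hκ hγ.1.1) measurable_const) hμ
  have he := hself γ hγ.1.1 (hγae hγ)
  have hγfin : γ Set.univ < ∞ := he ▸ hγ.1.2
  have hpγ : pairing κ γ γ = (γ Set.univ).toReal := congrArg ENNReal.toReal he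
  refine ⟨γ, hγ, hne, le_antisymm ?_ (le_of_not_gt fun hlt => ?_)⟩
  · rw [hpγ] at hle
    exact (ENNReal.toReal_le_toReal hγfin.ne hfin.ne).1 hle
  -- If `γ(X) < c_*(A)`, some unit `μ` on a compact subset has `γ(X) I(μ) < 1`, contradicting `1 =
  -- I(γ, μ)² ≤ γ(X) I(μ)`.
  · obtain ⟨K, hK, hKA, μ, hμ, hμlt⟩ := exists_energy_lt_of_lt_innerCapacity hlt
    have hμA := finiteEnergyOn_subset hKA hμ.1
    have h1 : pairing κ γ μ = 1 := by
      rw [pairing, mutualEnergy_comm hκ hγ.1.1 hμA.1.1, mutualEnergy_eq_lintegral hκ hγ.1.1,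
        lintegral_congr_ae (hγae hμA), lintegral_one, hμ.2, ENNReal.toReal_one]
    have h2 := pairing_sq_le hκ hE hγ.1 hμA.1
    rw [h1, hpγ] at h2
    have h3 : γ Set.univ * energy κ μ < 1 := by
      rcases eq_or_ne (γ Set.univ) 0 with h0 | h0
      · simp [h0]
      · rw [← ENNReal.mul_inv_cancel h0 hγfin.ne]
        exact ENNReal.mul_lt_mul_right h0 hγfin.ne hμlt
    have h4 := (ENNReal.toReal_lt_toReal (h3.trans ENNReal.one_lt_top).ne
      ENNReal.one_ne_top).2 h3
    rw [ENNReal.toReal_mul, ENNReal.toReal_one] at h4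
    change 1 ^ 2 ≤ (γ Set.univ).toReal * (energy κ μ).toReal at h2
    linarith

/-- Every competitor satisfies `I(μ, γ) = c_*(A) = ‖γ‖²`, so the energy principle makes `γ` the only
minimizer, hence the chosen one. -/
theorem innerEquilibrium_eq (hκ : IsKernel κ) (hE : EnergyPrinciple κ)
    (hγ : γ ∈ finiteEnergyOn κ A) (hne : NearlyEverywhere κ A (fun x => potential κ γ x = 1))
    (hmass : γ Set.univ = innerCapacity κ A) : innerEquilibrium κ A = γ := by
  have hγae := fun μ hμ => hne.ae (μ := μ) hκ
    (measurableSet_eq_fun (measurable_potential hκ hγ.1.1) measurable_const) hμ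
  have hpair : ∀ μ ∈ finiteEnergyOn κ A, μ Set.univ = innerCapacity κ A →
      mutualEnergy κ μ γ = innerCapacity κ A := fun μ hμ hm => by
    rw [mutualEnergy_eq_lintegral hκ hγ.1.1, lintegral_congr_ae (hγae μ hμ), lintegral_one, hm]
  have hγγ : energy κ γ = innerCapacity κ A := hpair γ hγ hmass
  have hfin : innerCapacity κ A < ∞ := hγγ ▸ hγ.1.2
  have hex : IsInnerEquilibrium κ A γ := by
    refine ⟨hγ, hmass, fun μ hμ hm => ?_⟩
    have h := hE.nonneg μ γ hμ.1.1 hγ.1.1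
    rw [hpair μ hμ hm, hγγ, two_mul] at h
    rw [hγγ]
    exact (ENNReal.add_le_add_iff_right hfin.ne).1 h
  have hex' : ∃ γ, IsInnerEquilibrium κ A γ := ⟨γ, hex⟩
  rw [innerEquilibrium, dif_pos hex']
  obtain ⟨h1, h2, h3⟩ := hex'.choose_spec
  refine hE.definite _ _ h1.1 hγ.1 (le_antisymm (hE.nonneg _ _ h1.1.1 hγ.1.1) ?_)
  have h4 := h3 γ hγ hmass
  rw [hpair _ h1 h2, two_mul]
  rw [hγγ] at h4 ⊢
  gcongr

/-- Integrate the inequality against the equilibrium measure `γ` of `K`: `U^γ` is one `μ`-a.e. and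
at most one everywhere. -/
theorem measure_univ_le_of_potential_le (hκ : IsKernel κ) (hE : EnergyPrinciple κ)
    (hC : ConsistencyPrinciple κ) (hF : FrostmanPrinciple κ) (hK : IsCompact K)
    (hω : IsRadon ω) (hμ : μ ∈ finiteEnergyOn κ K)
    (h : ∀ x, potential κ μ x ≤ potential κ ω x) : μ Set.univ ≤ ω Set.univ := by
  obtain ⟨γ, hγ, -, h1, h2⟩ := exists_minimizer_of_isCompact hκ hE hC hK measurable_const
    hF.dominates_one continuousOn_const (M := 1) (fun x _ => le_rfl)
  calc μ Set.univ = ∫⁻ x, potential κ γ x ∂μ := by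
        rw [lintegral_congr_ae (h1 μ hμ), lintegral_one]
    _ = ∫⁻ x, potential κ μ x ∂γ := lintegral_potential_comm hκ hμ.1.1 hγ.1.1
    _ ≤ ∫⁻ x, potential κ ω x ∂γ := lintegral_mono h
    _ = ∫⁻ x, potential κ γ x ∂ω := lintegral_potential_comm hκ hγ.1.1 hω
    _ ≤ ∫⁻ _, 1 ∂ω := lintegral_mono h2
    _ = ω Set.univ := lintegral_one

/-- Here `∫ U^ω dμ = I(μ, ω)` is strongly continuous and `‖μ - ω‖² ≥ 0` bounds the functional below,
so one can minimize over `𝓔⁺(A)` directly. -/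
theorem exists_isInnerBalayage_of_finite_energy (hκ : IsKernel κ) (hE : EnergyPrinciple κ)
    (hC : ConsistencyPrinciple κ) (hD : DominationPrinciple κ) (hcl : StronglyClosed κ A)
    (hω : ω ∈ finiteEnergy κ) : ∃ ν, IsInnerBalayage κ A ω ν := by
  have hp : ∀ μ : Measure X, (∫⁻ x, potential κ ω x ∂μ).toReal = pairing κ μ ω := fun μ => by
    rw [pairing, mutualEnergy_eq_lintegral hκ hω.1]
  obtain ⟨ν, hν, -, h, -⟩ := exists_minimizer hκ hE hC hcl (measurable_potential hκ hω.1)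
    (hD.dominates hω.1)
    (fun μ hμ => by
      rw [← mutualEnergy_eq_lintegral hκ hω.1]; exact mutualEnergy_lt_top hE hμ.1 hω)
    (b := -pairing κ ω ω)
    (fun μ hμ => by
      rw [quadraticFunctional, hp]
      linarith [two_mul_pairing_le hE hμ.1 hω])
    (fun u ν hu hν hs => by
      simp only [hp]
      exact hs.tendsto_pairing hκ hE (fun n => (hu n).1) hν.1 hω)
  exact ⟨ν, hν, nearlyEverywhere_of_forall_ae fun K _ hKA μ hμ =>
    h μ (finiteEnergyOn_subset hKA hμ)⟩

theorem exists_isInnerBalayage_of_bounded (hκ : IsKernel κ) (hE : EnergyPrinciple κ)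
    (hC : ConsistencyPrinciple κ) (hD : DominationPrinciple κ) (hF : FrostmanPrinciple κ)
    (hcl : StronglyClosed κ A) (hω : IsRadon ω) (hfin : ω Set.univ < ∞)
    (husc : ∀ K : Set X, IsCompact K → K ⊆ A → UpperSemicontinuousOn (potential κ ω) K)
    (hbdd : (⨆ x ∈ A, potential κ ω x) < ∞) : ∃ ν, IsInnerBalayage κ A ω ν := by
  obtain ⟨M, hM⟩ : ∃ M : ℝ≥0, (M : ℝ≥0∞) = ⨆ x ∈ A, potential κ ω x :=
    ⟨_, ENNReal.coe_toNNReal hbdd.ne⟩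
  have hle : ∀ x ∈ A, potential κ ω x ≤ M := fun x hx => by
    rw [hM]; exact le_iSup₂ (f := fun x (_ : x ∈ A) => potential κ ω x) x hx
  obtain ⟨ν, hν, h, -⟩ := exists_sweeping hκ hE hC hcl (measurable_potential hκ hω)
    (hD.dominates hω) (fun K hK hKA => continuousOn_iff_lower_upperSemicontinuousOn.2
      ⟨(lowerSemicontinuous_potential hκ ω).lowerSemicontinuousOn _, husc K hK hKA⟩) hle
    -- Sweeping onto `K` does not increase mass, so `‖μ‖² ≤ M μ(X) ≤ M ω(X)`.
    (B := ((M : ℝ≥0∞) * ω Set.univ).toReal) (fun K hK hKA μ hμ h1 h2 => by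
      refine ENNReal.toReal_mono (ENNReal.mul_lt_top ENNReal.coe_lt_top hfin).ne ?_
      have hK' : ∀ᵐ x ∂μ, x ∈ K := hμ.2
      calc mutualEnergy κ μ μ = ∫⁻ x, potential κ μ x ∂μ := mutualEnergy_eq_lintegral hκ hμ.1.1
        _ ≤ ∫⁻ _, M ∂μ := lintegral_mono_ae (by
            filter_upwards [hK'] with x hx using (h2 x).trans (hle x (hKA hx)))
        _ = M * μ Set.univ := lintegral_const _
        _ ≤ M * ω Set.univ := by
            refine mul_le_mul' le_rfl ?_
            exact measure_univ_le_of_potential_le hκ hE hC hF hK hω hμ h2)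
  exact ⟨ν, hν, h⟩

theorem isInnerBalayage_innerBalayage (hκ : IsKernel κ) (hE : EnergyPrinciple κ)
    (hC : ConsistencyPrinciple κ) (hD : DominationPrinciple κ) (hF : FrostmanPrinciple κ)
    (hcl : StronglyClosed κ A) (hω : AdmissibleCharge κ A ω) :
    IsInnerBalayage κ A ω (innerBalayage κ A ω) := by
  have hex : ∃ ν, IsInnerBalayage κ A ω ν := by
    rcases hω.finite_or_bounded with h | ⟨h1, h2, h3⟩
    · exact exists_isInnerBalayage_of_finite_energy hκ hE hC hD hcl ⟨hω.radon, h⟩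
    · exact exists_isInnerBalayage_of_bounded hκ hE hC hD hF hcl hω.radon h1 h2 h3
  rw [innerBalayage, dif_pos hex]
  exact hex.choose_spec

end Existence

/-! ### Three characterizations of a measure with constant weighted potential -/

section Characterization

variable {X : Type*} [TopologicalSpace X] [LocallyCompactSpace X] [T2Space X]
  [SecondCountableTopology X] [MeasurableSpace X] [BorelSpace X] {κ : X → X → ℝ≥0∞}
  {μ ν τ γ ω l : Measure X} {A : Set X} {c : ℝ} {x : X}

/-- Subtraction becomes addition in `ℝ≥0∞`; the condition `b ≠ ∞` reflects `a - ∞ = ⊥`, also for `a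
= ∞`. -/
theorem ereal_coe_le_sub_iff {a b : ℝ≥0∞} (hc : 0 ≤ c) :
    (c : EReal) ≤ (a : EReal) - (b : EReal) ↔ b ≠ ∞ ∧ b + ENNReal.ofReal c ≤ a := by
  induction b with
  | top => simp
  | coe b =>
    induction a with
    | top => simp
    | coe a =>
      simp only [EReal.coe_nnreal_eq_coe_real, ne_eq, ENNReal.coe_ne_top,
        not_false_eq_true, true_and]
      rw [← EReal.coe_sub, EReal.coe_le_coe_iff, ENNReal.ofReal, ← ENNReal.coe_add,
        ENNReal.coe_le_coe, ← NNReal.coe_le_coe, NNReal.coe_add, Real.coe_toNNReal _ hc,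
        le_sub_iff_add_le, add_comm]

theorem ereal_sub_eq_coe_iff {a b : ℝ≥0∞} (hc : 0 ≤ c) :
    (a : EReal) - (b : EReal) = (c : EReal) ↔ b ≠ ∞ ∧ a = b + ENNReal.ofReal c := by
  induction b with
  | top => simp
  | coe b =>
    induction a with
    | top => simpa using (ENNReal.add_ne_top.2 ⟨ENNReal.coe_ne_top, ENNReal.ofReal_ne_top⟩).symm
    | coe a =>
      simp only [EReal.coe_nnreal_eq_coe_real, ne_eq, ENNReal.coe_ne_top,
        not_false_eq_true, true_and]
      rw [← EReal.coe_sub, EReal.coe_eq_coe_iff, ENNReal.ofReal, ← ENNReal.coe_add,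
        ENNReal.coe_inj, ← NNReal.coe_inj, NNReal.coe_add, Real.coe_toNNReal _ hc,
        sub_eq_iff_eq_add, add_comm]

theorem coe_le_weightedPotential_iff (hc : 0 ≤ c) :
    (c : EReal) ≤ weightedPotential κ ω μ x ↔
      potential κ ω x ≠ ∞ ∧ potential κ ω x + ENNReal.ofReal c ≤ potential κ μ x :=
  ereal_coe_le_sub_iff hc

theorem weightedPotential_eq_iff (hc : 0 ≤ c) :
    weightedPotential κ ω μ x = (c : EReal) ↔
      potential κ ω x ≠ ∞ ∧ potential κ μ x = potential κ ω x + ENNReal.ofReal c :=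
  ereal_sub_eq_coe_iff hc

theorem nearlyEverywhere_weightedPotential_ge_iff (hκ : IsKernel κ) (hω : IsRadon ω)
    (hμ : IsRadon μ) (hc : 0 ≤ c) :
    NearlyEverywhere κ A (fun x => (c : EReal) ≤ weightedPotential κ ω μ x) ↔
      ∀ σ ∈ finiteEnergyOn κ A, ∀ᵐ x ∂σ,
        potential κ ω x ≠ ∞ ∧ potential κ ω x + ENNReal.ofReal c ≤ potential κ μ x := by
  have hm := measurable_potential hκ hω
  simp only [coe_le_weightedPotential_iff hc]
  exact nearlyEverywhere_iff hκ (((hm (measurableSet_singleton ∞)).compl).inter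
    (measurableSet_le (hm.add_const _) (measurable_potential hκ hμ)))

theorem nearlyEverywhere_weightedPotential_eq_iff (hκ : IsKernel κ) (hω : IsRadon ω)
    (hμ : IsRadon μ) (hc : 0 ≤ c) :
    NearlyEverywhere κ A (fun x => weightedPotential κ ω μ x = (c : EReal)) ↔
      ∀ σ ∈ finiteEnergyOn κ A, ∀ᵐ x ∂σ,
        potential κ ω x ≠ ∞ ∧ potential κ μ x = potential κ ω x + ENNReal.ofReal c := by
  have hm := measurable_potential hκ hω
  simp only [weightedPotential_eq_iff hc]
  exact nearlyEverywhere_iff hκ (((hm (measurableSet_singleton ∞)).compl).inter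
    (measurableSet_eq_fun (measurable_potential hκ hμ) (hm.add_const _)))

theorem pairing_mono_of_ae (hκ : IsKernel κ) (hE : EnergyPrinciple κ) (hμ : μ ∈ finiteEnergy κ)
    (hν : ν ∈ finiteEnergy κ) (hτ : τ ∈ finiteEnergy κ)
    (h : ∀ᵐ x ∂τ, potential κ μ x ≤ potential κ ν x) : pairing κ τ μ ≤ pairing κ τ ν := by
  refine ENNReal.toReal_mono (mutualEnergy_lt_top hE hτ hν).ne ?_
  rw [mutualEnergy_eq_lintegral hκ hμ.1, mutualEnergy_eq_lintegral hκ hν.1]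
  exact lintegral_mono_ae h

/-- Two measures of finite energy whose potentials coincide almost everywhere with respect to
both of them are equal. -/
theorem eq_of_ae_potential_eq (hκ : IsKernel κ) (hE : EnergyPrinciple κ) (hμ : μ ∈ finiteEnergy κ)
    (hν : ν ∈ finiteEnergy κ) (h1 : ∀ᵐ x ∂μ, potential κ μ x = potential κ ν x)
    (h2 : ∀ᵐ x ∂ν, potential κ μ x = potential κ ν x) : μ = ν := by
  refine eq_of_le_two_mul_pairing hE hμ hν ?_
  have e1 := pairing_mono_of_ae hκ hE hμ hν hμ (by filter_upwards [h1] with x hx using hx.le)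
  have e2 := pairing_mono_of_ae hκ hE hν hμ hν (by filter_upwards [h2] with x hx using hx.ge)
  rw [pairing_comm hκ hν.1 hμ.1] at e2
  linarith

variable (hκ : IsKernel κ) (hE : EnergyPrinciple κ) (hD : DominationPrinciple κ)
  (hω : IsRadon ω) (hl : l ∈ finiteEnergyOn κ A) (hc : 0 ≤ c)
  (hne : NearlyEverywhere κ A (fun x => weightedPotential κ ω l x = (c : EReal)))

include hκ hω hl hc hne

theorem mem_weightedClass_of_weightedPotential_eq : l ∈ weightedClass κ A ω c := by
  refine ⟨hl.1, (nearlyEverywhere_weightedPotential_ge_iff hκ hω hl.1.1 hc).2 fun σ hσ => ?_⟩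
  filter_upwards [(nearlyEverywhere_weightedPotential_eq_iff hκ hω hl.1.1 hc).1 hne σ hσ]
    with x hx using ⟨hx.1, hx.2.ge⟩

include hD in
-- `l` lives on `A`, so `U^l = U^ω + c ≤ U^ν` holds `l`-a.e., and domination removes the exceptional
-- set.
theorem potential_le_of_mem_weightedClass (hν : ν ∈ weightedClass κ A ω c) (x : X) :
    potential κ l x ≤ potential κ ν x := by
  refine hD l ν hl.1 hν.1.1 ?_ x
  filter_upwards [(nearlyEverywhere_weightedPotential_eq_iff hκ hω hl.1.1 hc).1 hne l hl,
    (nearlyEverywhere_weightedPotential_ge_iff hκ hω hν.1.1 hc).1 hν.2 l hl] with x h1 h2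
  exact h1.2.trans_le h2.2

include hE hD

theorem minimal_potential_iff :
    (μ ∈ weightedClass κ A ω c ∧
      ∀ ν ∈ weightedClass κ A ω c, ∀ x, potential κ μ x ≤ potential κ ν x) ↔ μ = l := by
  have hmem := mem_weightedClass_of_weightedPotential_eq hκ hω hl hc hne
  have hle := fun ν hν => potential_le_of_mem_weightedClass (ν := ν) hκ hD hω hl hc hne hν
  constructor
  · rintro ⟨hμ, h⟩
    have heq : ∀ x, potential κ μ x = potential κ l x := fun x =>
      le_antisymm (h l hmem x) (hle μ hμ x)
    exact eq_of_ae_potential_eq hκ hE hμ.1 hl.1 (ae_of_all _ heq) (ae_of_all _ heq)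
  · rintro rfl
    exact ⟨hmem, hle⟩

theorem minimal_energyNorm_iff :
    (μ ∈ weightedClass κ A ω c ∧
      ∀ ν ∈ weightedClass κ A ω c, energyNorm κ μ ≤ energyNorm κ ν) ↔ μ = l := by
  have hmem := mem_weightedClass_of_weightedPotential_eq hκ hω hl hc hne
  have hle := fun ν hν => potential_le_of_mem_weightedClass (ν := ν) hκ hD hω hl hc hne hν
  -- Integrating `U^l ≤ U^ν` against `l` and against `ν` gives `‖l‖² ≤ I(l, ν) ≤ ‖ν‖²`.
  have h1 : ∀ ν ∈ weightedClass κ A ω c, pairing κ l l ≤ pairing κ l ν := fun ν hν =>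
    pairing_mono_of_ae hκ hE hl.1 hν.1 hl.1 (ae_of_all _ (hle ν hν))
  have h2 : ∀ ν ∈ weightedClass κ A ω c, pairing κ l ν ≤ pairing κ ν ν := fun ν hν => by
    rw [pairing_comm hκ hl.1.1 hν.1.1]
    exact pairing_mono_of_ae hκ hE hl.1 hν.1 hν.1 (ae_of_all _ (hle ν hν))
  constructor
  · rintro ⟨hμ, h⟩
    refine eq_of_le_two_mul_pairing hE hμ.1 hl.1 ?_
    have h3 : pairing κ μ μ ≤ pairing κ l l :=
      (Real.sqrt_le_sqrt_iff (pairing_nonneg κ l l)).1 (h l hmem)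
    have h4 := h1 μ hμ
    rw [pairing_comm hκ hl.1.1 hμ.1.1] at h4
    linarith
  · rintro rfl
    exact ⟨hmem, fun ν hν => Real.sqrt_le_sqrt ((h1 ν hν).trans (h2 ν hν))⟩

omit hD in
theorem weightedPotential_eq_const_iff :
    (μ ∈ finiteEnergyOn κ A ∧
      NearlyEverywhere κ A (fun x => weightedPotential κ ω μ x = (c : EReal))) ↔ μ = l := by
  constructor
  · rintro ⟨hμ, h⟩
    have heq : ∀ σ ∈ finiteEnergyOn κ A, ∀ᵐ x ∂σ, potential κ μ x = potential κ l x := by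
      intro σ hσ
      filter_upwards [(nearlyEverywhere_weightedPotential_eq_iff hκ hω hμ.1.1 hc).1 h σ hσ,
        (nearlyEverywhere_weightedPotential_eq_iff hκ hω hl.1.1 hc).1 hne σ hσ] with x h1 h2
      rw [h1.2, h2.2]
    exact eq_of_ae_potential_eq hκ hE hμ.1 hl.1 (heq μ hμ) (heq l hl)
  · rintro rfl
    exact ⟨hl, hne⟩

end Characterization

/-! ### The Gauss functional and its minimizer -/

section Gauss

variable {X : Type*} [TopologicalSpace X] [LocallyCompactSpace X] [T2Space X]
  [SecondCountableTopology X] [MeasurableSpace X] [BorelSpace X] {κ : X → X → ℝ≥0∞}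
  {μ ν τ γ ω l m : Measure X} {A : Set X} {c : ℝ}

theorem IsInnerBalayage.ae_eq (hκ : IsKernel κ) (hω : IsRadon ω) (hν : IsInnerBalayage κ A ω ν)
    (hμ : μ ∈ finiteEnergyOn κ A) : ∀ᵐ x ∂μ, potential κ ν x = potential κ ω x :=
  hν.2.ae hκ (measurableSet_eq_fun (measurable_potential hκ hν.1.1.1)
    (measurable_potential hκ hω)) hμ

theorem ae_potential_lt_top (hκ : IsKernel κ) (hE : EnergyPrinciple κ) (hν : ν ∈ finiteEnergy κ)
    (hμ : μ ∈ finiteEnergy κ) : ∀ᵐ x ∂μ, potential κ ν x < ∞ := by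
  refine ae_lt_top (measurable_potential hκ hν.1) ?_
  rw [← mutualEnergy_eq_lintegral hκ hν.1]
  exact (mutualEnergy_lt_top hE hμ hν).ne

/-- The right side is `‖μ - ν‖² - ‖ν‖²`, even when `ω` has infinite energy: `U^ω = U^ν < ∞` `μ`-a.e.
-/
theorem gaussFunctional_eq (hκ : IsKernel κ) (hE : EnergyPrinciple κ) (hω : IsRadon ω)
    (hν : IsInnerBalayage κ A ω ν) (hμ : μ ∈ finiteEnergyOn κ A) :
    gaussFunctional κ ω μ = pairing κ μ μ - 2 * pairing κ μ ν := by
  have hae := hν.ae_eq hκ hω hμ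
  rw [gaussFunctional, energyNorm, Real.sq_sqrt ENNReal.toReal_nonneg,
    integral_toReal (measurable_potential hκ hω).aemeasurable (by
      filter_upwards [hae, ae_potential_lt_top hκ hE hν.1.1 hμ.1] with x h1 h2 using h1 ▸ h2),
    ← lintegral_congr_ae hae, ← mutualEnergy_eq_lintegral hκ hν.1.1.1]
  rfl

theorem equilibriumConstant_eq (hκ : IsKernel κ) (hω : IsRadon ω)
    (hl : l ∈ unitFiniteEnergyOn κ A) (hc : 0 ≤ c)
    (hne : NearlyEverywhere κ A (fun x => weightedPotential κ ω l x = (c : EReal))) :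
    equilibriumConstant κ ω l = c := by
  have h := (nearlyEverywhere_weightedPotential_eq_iff hκ hω hl.1.1.1 hc).1 hne l hl.1
  rw [equilibriumConstant, integral_congr_ae (g := fun _ => c) (by
    filter_upwards [h] with x hx
    rw [(weightedPotential_eq_iff hc).2 hx, EReal.toReal_coe])]
  simp [Measure.real, hl.2]

/-- A unit measure on `A` with nearly everywhere constant weighted potential is the minimizer of
the Gauss functional. -/
theorem IsGaussMinimizer.eq_of_weightedPotential_eq (hκ : IsKernel κ) (hE : EnergyPrinciple κ)
    (hω : IsRadon ω) (hν : IsInnerBalayage κ A ω ν) (hl : IsGaussMinimizer κ A ω l)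
    (hm : m ∈ unitFiniteEnergyOn κ A) (hc : 0 ≤ c)
    (hne : NearlyEverywhere κ A (fun x => weightedPotential κ ω m x = (c : EReal))) : l = m := by
  have h := (nearlyEverywhere_weightedPotential_eq_iff hκ hω hm.1.1.1 hc).1 hne
  have hpair : ∀ μ ∈ unitFiniteEnergyOn κ A, pairing κ μ m = pairing κ μ ν + c := by
    intro μ hμ
    have hae : potential κ m =ᵐ[μ] fun x => potential κ ν x + ENNReal.ofReal c := by
      filter_upwards [h μ hμ.1, hν.ae_eq hκ hω hμ.1] with x h1 h2
      rw [h1.2, h2]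
    rw [pairing, mutualEnergy_eq_lintegral hκ hm.1.1.1, lintegral_congr_ae hae,
      lintegral_add_right _ measurable_const, lintegral_const, hμ.2, mul_one,
      ← mutualEnergy_eq_lintegral hκ hν.1.1.1, ENNReal.toReal_add
        (mutualEnergy_lt_top hE hμ.1.1 hν.1.1).ne ENNReal.ofReal_ne_top, ENNReal.toReal_ofReal hc]
    rfl
  -- By `hpair` the constant `c` contributes equally to both sides, leaving `‖l - m‖² ≤ 0`.
  have hle := hl.2 m hm
  rw [gaussFunctional_eq hκ hE hω hν hl.1.1, gaussFunctional_eq hκ hE hω hν hm.1] at hle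
  have h1 := hpair l hl.1
  have h2 := hpair m hm
  exact eq_of_le_two_mul_pairing hE hl.1.1.1 hm.1.1 (by linarith)

theorem IsGaussMinimizer.eq_of_innerCapacity_eq_top (hκ : IsKernel κ) (hE : EnergyPrinciple κ)
    (hω : IsRadon ω) (hν : IsInnerBalayage κ A ω ν) (hmass : ν Set.univ ≤ 1)
    (hl : IsGaussMinimizer κ A ω l) (hcap : innerCapacity κ A = ∞) : l = ν := by
  refine eq_of_le_two_mul_pairing hE hl.1.1.1 hν.1.1 (le_of_forall_pos_le_add fun ε hε => ?_)
  -- Take a unit `τ` of energy below `ε` and `s = 1 - ν(X)`. The functional at `ν + s τ` is `-‖ν‖² +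
  -- s²‖τ‖²`, as the cross terms cancel; hence `‖l - ν‖² ≤ ε`.
  obtain ⟨K, hK, hKA, τ, hτ, hlt⟩ := exists_energy_lt_of_lt_innerCapacity (κ := κ) (A := A)
    (r := (ENNReal.ofReal ε)⁻¹) (by rw [hcap]; simpa using hε)
  have hτA := finiteEnergyOn_subset hKA hτ.1
  rw [inv_inv] at hlt
  have hτε : pairing κ τ τ ≤ ε := ENNReal.toReal_le_of_le_ofReal hε.le hlt.le
  obtain ⟨s, hs⟩ : ∃ s : ℝ≥0, (s : ℝ≥0∞) = 1 - ν Set.univ :=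
    ⟨_, ENNReal.coe_toNNReal (ENNReal.sub_ne_top ENNReal.one_ne_top)⟩
  have hs1 : (s : ℝ) ≤ 1 := by
    have : (s : ℝ≥0∞) ≤ 1 := hs ▸ tsub_le_self
    exact_mod_cast this
  have hsτ := smul_mem_finiteEnergyOn hκ hτA s
  have hmem : ν + (s : ℝ≥0∞) • τ ∈ unitFiniteEnergyOn κ A := by
    refine ⟨add_mem_finiteEnergyOn hκ hE hν.1 hsτ, ?_⟩
    rw [Measure.add_apply, Measure.smul_apply, hτ.2, smul_eq_mul, mul_one, hs,
      add_tsub_cancel_of_le hmass]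
  have hle := hl.2 _ hmem
  rw [gaussFunctional_eq hκ hE hω hν hl.1.1, gaussFunctional_eq hκ hE hω hν hmem.1,
    pairing_add_smul_self hκ hE hν.1.1 hτA.1, pairing_add_left hκ hE hν.1.1 hsτ.1 hν.1.1,
    pairing_smul_left hκ hν.1.1, pairing_comm hκ hτA.1.1 hν.1.1.1] at hle
  have hs2 : (s : ℝ) ^ 2 * pairing κ τ τ ≤ ε := by
    have : (s : ℝ) ^ 2 ≤ 1 := pow_le_one₀ s.2 hs1
    nlinarith [pairing_nonneg κ τ τ]
  linarith

theorem IsInnerBalayage.weightedPotential_eq_zero (hκ : IsKernel κ) (hE : EnergyPrinciple κ)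
    (hω : IsRadon ω) (hν : IsInnerBalayage κ A ω ν) :
    NearlyEverywhere κ A (fun x => weightedPotential κ ω ν x = ((0 : ℝ) : EReal)) := by
  refine (nearlyEverywhere_weightedPotential_eq_iff hκ hω hν.1.1.1 le_rfl).2 fun σ hσ => ?_
  filter_upwards [hν.ae_eq hκ hω hσ, ae_potential_lt_top hκ hE hν.1.1 hσ.1] with x h1 h2
  exact ⟨h1 ▸ h2.ne, by simp [h1]⟩

/-- The inner balayage of `ω`, corrected by a multiple of the inner equilibrium measure. -/
theorem nearlyEverywhere_weightedPotential_add_smul (hκ : IsKernel κ) (hE : EnergyPrinciple κ)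
    (hω : IsRadon ω) (hν : IsInnerBalayage κ A ω ν) (hγ : γ ∈ finiteEnergyOn κ A)
    (hγ1 : NearlyEverywhere κ A (fun x => potential κ γ x = 1)) (hc : 0 ≤ c) :
    NearlyEverywhere κ A (fun x =>
      weightedPotential κ ω (ν + ENNReal.ofReal c • γ) x = (c : EReal)) := by
  have hr : IsRadon (ν + ENNReal.ofReal c • γ) := hν.1.1.1.add (hγ.1.1.smul c.toNNReal)
  refine (nearlyEverywhere_weightedPotential_eq_iff hκ hω hr hc).2 fun σ hσ => ?_
  filter_upwards [hν.ae_eq hκ hω hσ, ae_potential_lt_top hκ hE hν.1.1 hσ.1,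
    hγ1.ae hκ (measurableSet_eq_fun (measurable_potential hκ hγ.1.1) measurable_const) hσ]
    with x h1 h2 h3
  refine ⟨h1 ▸ h2.ne, ?_⟩
  rw [potential_add, potential_smul, h1, h3, mul_one]

end Gauss

end Balayage

/-! ### Main theorem -/

theorem mainTheorem4 {X : Type*} [TopologicalSpace X] [LocallyCompactSpace X] [T2Space X]
    [SecondCountableTopology X] [MeasurableSpace X] [BorelSpace X]
    (κ : X → X → ℝ≥0∞) (hκ : IsKernel κ) (hE : EnergyPrinciple κ) (hC : ConsistencyPrinciple κ)
    (hD : DominationPrinciple κ) (hF : FrostmanPrinciple κ)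
    (A : Set X) (hA : 0 < innerCapacity κ A) (hcl : StronglyClosed κ A)
    (ω : Measure X) (hω : AdmissibleCharge κ A ω)
    (l : Measure X) (hl : IsGaussMinimizer κ A ω l)
    (hmass : innerBalayage κ A ω Set.univ ≤ 1)
    (c : ℝ) (hc : c = equilibriumConstant κ ω l) :
    -- the representation of the solution
    (innerCapacity κ A < ∞ →
      l = innerBalayage κ A ω + ENNReal.ofReal c • innerEquilibrium κ A) ∧
    (innerCapacity κ A = ∞ → l = innerBalayage κ A ω) ∧
    -- the unique measure of minimum potential
    (∀ μ : Measure X,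
      (μ ∈ weightedClass κ A ω c ∧
        ∀ ν ∈ weightedClass κ A ω c, ∀ x, potential κ μ x ≤ potential κ ν x) ↔ μ = l) ∧
    -- the unique measure of minimum energy norm
    (∀ μ : Measure X,
      (μ ∈ weightedClass κ A ω c ∧
        ∀ ν ∈ weightedClass κ A ω c, energyNorm κ μ ≤ energyNorm κ ν) ↔ μ = l) ∧
    -- the unique measure in the cone with constant weighted potential n.e. on the set
    (∀ μ : Measure X,
      (μ ∈ finiteEnergyOn κ A ∧
        NearlyEverywhere κ A (fun x => weightedPotential κ ω μ x = (c : EReal))) ↔ μ = l) ∧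
    -- the sign of the constant
    (innerCapacity κ A < ∞ → 0 ≤ c) ∧
    (innerCapacity κ A = ∞ → c = 0) := by
  have hbal := isInnerBalayage_innerBalayage hκ hE hC hD hF hcl hω
  set ν := innerBalayage κ A ω with hνdef
  have hr := hω.radon
  obtain ⟨h0, hne, hlt, htop⟩ : 0 ≤ c ∧
      NearlyEverywhere κ A (fun x => weightedPotential κ ω l x = (c : EReal)) ∧
      (innerCapacity κ A < ∞ → l = ν + ENNReal.ofReal c • innerEquilibrium κ A) ∧
      (innerCapacity κ A = ∞ → l = ν ∧ c = 0) := by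
    rcases lt_or_eq_of_le (le_top (a := innerCapacity κ A)) with hcap | hcap
    · obtain ⟨γ, hγ, hγ1, hγm⟩ := exists_equilibrium hκ hE hC hF hcl hcap
      rw [innerEquilibrium_eq hκ hE hγ hγ1 hγm]
      -- The factor that gives `ν + s γ` mass one: `ν(X) ≤ 1` keeps the subtraction from truncating,
      -- and `c_*(A) > 0` keeps `s` finite.
      set s : ℝ≥0∞ := (1 - ν Set.univ) / innerCapacity κ A with hs
      have hsfin : s ≠ ∞ :=
        ENNReal.div_ne_top (ENNReal.sub_ne_top ENNReal.one_ne_top) hA.ne'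
      have hs' : ENNReal.ofReal s.toReal = s := ENNReal.ofReal_toReal hsfin
      have hs0 : 0 ≤ s.toReal := ENNReal.toReal_nonneg
      have hm : ν + ENNReal.ofReal s.toReal • γ ∈ unitFiniteEnergyOn κ A := by
        refine ⟨add_mem_finiteEnergyOn hκ hE hbal.1
          (smul_mem_finiteEnergyOn hκ hγ s.toReal.toNNReal), ?_⟩
        rw [Measure.add_apply, Measure.smul_apply, hγm, hs', smul_eq_mul, hs,
          ENNReal.div_mul_cancel hA.ne' hcap.ne, add_tsub_cancel_of_le hmass]
      have hmne := nearlyEverywhere_weightedPotential_add_smul hκ hE hr hbal hγ hγ1 hs0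
      have hlm := hl.eq_of_weightedPotential_eq hκ hE hr hbal hm hs0 hmne
      have hcs : c = s.toReal := by
        rw [hc, hlm, equilibriumConstant_eq hκ hr hm hs0 hmne]
      rw [hcs]
      exact ⟨hs0, hlm ▸ hmne, fun _ => hlm, fun h => absurd h hcap.ne⟩
    · have hlν := hl.eq_of_innerCapacity_eq_top hκ hE hr hbal hmass hcap
      have hmne := hbal.weightedPotential_eq_zero hκ hE hr
      rw [← hlν] at hmne
      have hc0 : c = 0 := hc.trans (equilibriumConstant_eq hκ hr hl.1 le_rfl hmne)
      subst hc0
      exact ⟨le_rfl, hmne, fun h => absurd hcap h.ne, fun _ => ⟨hlν, rfl⟩⟩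
  exact ⟨hlt, fun h => (htop h).1,
    fun μ => minimal_potential_iff hκ hE hD hr hl.1.1 h0 hne,
    fun μ => minimal_energyNorm_iff hκ hE hD hr hl.1.1 h0 hne,
    fun μ => weightedPotential_eq_const_iff hκ hE hr hl.1.1 h0 hne,
    fun _ => h0, fun h => (htop h).2⟩
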